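/- Let $n\ge 2$ and $m\ge 0$ be integers. Let $\mathcal E'(S^p)$ be the space of compactly supported (complex-valued) distributional symmetric $p$-tensor fields on $\mathbb R^n$, i.e. families $f=(f_{i_1\cdots i_p})$ of distributions $f_{i_1\cdots i_p}\in\mathcal E'(\mathbb R^n)$ symmetric in the indices, and let $\mathcal E'(\mathbf S^m)=\bigoplus_{p=0}^m\mathcal E'(S^p)$. For $F=\sum_{p=0}^m f^{(p)}\in\mathcal E'(\mathbf S^m)$ and an integer $k\ge 0$, let $J^{m,k}F$ be the $k$-th momentum ray transform of $F$ on the unit sphere bundle $\mathbb R^n\times\mathbb S^{n-1}$, that is, the distribution defined by $$\langle J^{m,k}F,\Psi\rangle=\sum_{p=0}^m\ \sum_{i_1,\dots,i_p=1}^n\Big\langle f^{(p)}_{i_1\cdots i_p},\ \int_{\mathbb S^{n-1}}\int_{\mathbb R}t^k\,\xi^{i_1}\cdots\xi^{i_p}\,\Psi(x-t\xi,\xi)\,dt\,dS(\xi)\Big\rangle,\qquad \Psi\in C_c^\infty(\mathbb R^n\times\mathbb S^{n-1});$$ for smooth compactly supported $F$ it is the function $J^{m,k}F(x,\xi)=\int_{\mathbb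 R}t^k\sum_{p=0}^m f^{(p)}_{i_1\cdots i_p}(x+t\xi)\,\xi^{i_1}\cdots\xi^{i_p}\,dt$ (summation over repeated indices), $|\xi|=1$. Let $i_\delta$ be the operator from symmetric $p$-tensor fields to symmetric $(p+2)$-tensor fields given by $(i_\delta f)_{i_1\cdots i_{p+2}}=\sigma(i_1\cdots i_{p+2})\,f_{i_1\cdots i_p}\delta_{i_{p+1}i_{p+2}}$, where $\sigma$ is symmetrization (averaging over all permutations of the indices), and let $i_\delta^j$ be its $j$-fold composition. Write $[\cdot]$ for the integer part. **Theorem.** Let $F=\sum_{p=0}^m f^{(p)}\in\mathcal E'(\mathbf S^m)$. 1. If $m\ge 2$, the following are equivalent: (a) $J^{m,m}F=0$ on $\mathbb R^n\times\mathbb S^{n-1}$; (b) $J^{m,k}F=0$ on $\mathbb R^n\times\mathbb S^{n-1}$ for all $k=0,1,\dots,m$; (c) $$f^{(2[\frac m2])}=-i_\delta\Big(\sum_{l=1}^{[\frac m2]}i_\delta^{[\frac m2]-l}f^{(2l-2)}\Big)\quad\text{and}\quad f^{(2[\frac{m-1}2]+1)}=-i_\delta\Big(\sum_{l=1}^{[\frac{m-1}2]}i_\delta^{[\frac{m-1}2]-l}f^{(2l-1)}\Big),$$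 where an empty sum is $0$. 2. If $m\in\{0,1\}$, then $J^{m,m}F=0$ on $\mathbb R^n\times\mathbb S^{n-1}$ if and only if $J^{m,k}F=0$ for all $0\le k\le m$, if and only if $F=0$. -/

import Mathlib

open MeasureTheory
open scoped ContDiff Convolution

noncomputable section

namespace MRT

/-- Euclidean space `ℝⁿ`. -/
abbrev Euc (n : ℕ) : Type := EuclideanSpace ℝ (Fin n)

/-- `C^∞(ℝⁿ)`: smooth complex-valued functions on `ℝⁿ`, with no support condition. -/
def Smooth (n : ℕ) : Submodule ℂ (Euc n → ℂ) where
  carrier := {φ | ContDiff ℝ ∞ φ}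
  add_mem' ha hb := ContDiff.add (𝕜 := ℝ) (n := ∞) ha hb
  zero_mem' := contDiff_const (𝕜 := ℝ) (n := ∞) (c := (0 : ℂ))
  smul_mem' c _ hf := ContDiff.const_smul (𝕜 := ℝ) (n := ∞) c hf

/-- `T` is continuous on `C^∞(ℝⁿ)` (uniform convergence of all derivatives on compact sets):
for some compact `K`, order `N` and constant `C`, one has
`|T φ| ≤ C sup_{x ∈ K, j ≤ N} ‖D^j φ(x)‖` for all `φ`; the supremum is replaced by its
arbitrary nonnegative upper bounds `B`. -/
def IsContinuousFunctional {n : ℕ} (T : Smooth n →ₗ[ℂ] ℂ) : Prop :=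
  ∃ (K : Set (Euc n)) (N : ℕ) (C : ℝ), IsCompact K ∧ 0 ≤ C ∧
    ∀ (φ : Smooth n) (B : ℝ), 0 ≤ B →
      (∀ j ≤ N, ∀ x ∈ K, ‖iteratedFDeriv ℝ j φ.1 x‖ ≤ B) → ‖T φ‖ ≤ C * B

/-- `ℰ'(ℝⁿ)`: compactly supported distributions, the continuous dual of `C^∞(ℝⁿ)`. -/
def CompactDistribution (n : ℕ) : Submodule ℂ (Smooth n →ₗ[ℂ] ℂ) where
  carrier := {T | IsContinuousFunctional T}
  zero_mem' := ⟨∅, 0, 0, isCompact_empty, le_rfl, fun φ B _ _ => by simp⟩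
  add_mem' := by
    rintro S T ⟨K, N, C, hK, hC, hS⟩ ⟨K', N', C', hK', hC', hT⟩
    refine ⟨K ∪ K', max N N', C + C', hK.union hK', add_nonneg hC hC', fun φ B hB h => ?_⟩
    have h1 := hS φ B hB fun j hj x hx => h j (hj.trans (le_max_left _ _)) x (Or.inl hx)
    have h2 := hT φ B hB fun j hj x hx => h j (hj.trans (le_max_right _ _)) x (Or.inr hx)
    calc ‖(S + T) φ‖ ≤ ‖S φ‖ + ‖T φ‖ := norm_add_le _ _
      _ ≤ (C + C') * B := by linarith
  smul_mem' := by
    rintro c T ⟨K, N, C, hK, hC, hT⟩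
    refine ⟨K, N, ‖c‖ * C, hK, by positivity, fun φ B hB h => ?_⟩
    have h1 := hT φ B hB h
    calc ‖(c • T) φ‖ = ‖c‖ * ‖T φ‖ := norm_smul c (T φ)
      _ ≤ ‖c‖ * (C * B) := by gcongr
      _ = ‖c‖ * C * B := by ring

/-- `ℰ'(S^p)`: compactly supported distributional symmetric `p`-tensor fields on `ℝⁿ`,
given by components `f_{i₁ … i_p} ∈ ℰ'(ℝⁿ)` invariant under permutation of the indices. -/
def SymTensor (n p : ℕ) : Submodule ℂ ((Fin p → Fin n) → CompactDistribution n) where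
  carrier := {f | ∀ (π : Equiv.Perm (Fin p)) (I : Fin p → Fin n), f (I ∘ π) = f I}
  zero_mem' _ _ := rfl
  add_mem' ha hb π I := by simp only [Pi.add_apply, ha π I, hb π I]
  smul_mem' c _ hf π I := by simp only [Pi.smul_apply, hf π I]

/-- `ℰ'(𝐒^m)`: the elements `F = ∑_{p=0}^m f^{(p)}` of `⨁_{p=0}^m ℰ'(S^p)`. -/
abbrev TensorSum (n m : ℕ) : Type := (p : Fin (m + 1)) → SymTensor n p

/-- `(i_δ f)_{i₁ … i_{p+2}} = σ(i₁ … i_{p+2}) f_{i₁ … i_p} δ_{i_{p+1} i_{p+2}}`, with `σ` the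
symmetrization (the average over all permutations of the indices). -/
def iDelta {n p : ℕ} (f : SymTensor n p) : SymTensor n (p + 2) :=
  ⟨fun I => ((p + 2).factorial : ℂ)⁻¹ • ∑ π : Equiv.Perm (Fin (p + 2)),
      if I (π (Fin.natAdd p 0)) = I (π (Fin.natAdd p 1)) then
        f.1 (fun j => I (π (Fin.castAdd 2 j))) else 0, by
    intro τ I
    dsimp only
    congr 1
    exact Fintype.sum_equiv (Equiv.mulLeft τ) _ _ fun π => rfl⟩

/-- `i_δ^j`, which raises the rank by `2 j`. -/
def iDeltaPow {n p : ℕ} : (j : ℕ) → SymTensor n p → SymTensor n (p + 2 * j)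
  | 0, f => f
  | j + 1, f => iDelta (iDeltaPow j f)

/-- `i_δ^j` with the rank `p + 2 j` of the result written as `q`. -/
def iDeltaPowTo {n p q : ℕ} (j : ℕ) (h : p + 2 * j = q) (f : SymTensor n p) : SymTensor n q :=
  h ▸ iDeltaPow j f

/-- `C_c^∞(ℝⁿ × (ℝⁿ ∖ {0}))`. The restrictions of these functions to `ℝⁿ × 𝕊^{n-1}` are exactly
the elements of `C_c^∞(ℝⁿ × 𝕊^{n-1})`. -/
structure TestFunction (n : ℕ) where
  toFun : Euc n × Euc n → ℂ
  smooth : ContDiff ℝ ∞ toFun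
  compact : HasCompactSupport toFun
  support_ne : ∀ q ∈ tsupport toFun, q.2 ≠ 0

/-- The integrand `t^k ξ^{i₁} ⋯ ξ^{i_p} Ψ(x - t ξ, ξ)`. -/
def adjointIntegrand {n p : ℕ} (k : ℕ) (Ψ : TestFunction n) (I : Fin p → Fin n)
    (x ξ : Euc n) (t : ℝ) : ℂ :=
  (t : ℂ) ^ k * (∏ j, (ξ (I j) : ℂ)) * Ψ.toFun (x - t • ξ, ξ)

theorem adjointIntegrand_contDiff {n p : ℕ} (k : ℕ) (Ψ : TestFunction n) (I : Fin p → Fin n) :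
    ContDiff ℝ ∞ (fun q : Euc n × (Euc n × ℝ) => adjointIntegrand k Ψ I q.1 q.2.1 q.2.2) := by
  have hc : ContDiff ℝ ∞ (fun r : ℝ => (r : ℂ)) := Complex.ofRealCLM.contDiff
  have h1 : ContDiff ℝ ∞ (fun q : Euc n × (Euc n × ℝ) => ((q.2.2 : ℝ) : ℂ)) :=
    hc.comp (contDiff_snd.comp contDiff_snd)
  have h2 : ∀ i, ContDiff ℝ ∞ (fun q : Euc n × (Euc n × ℝ) => ((q.2.1 i : ℝ) : ℂ)) := fun i =>
    hc.comp ((EuclideanSpace.proj i : Euc n →L[ℝ] ℝ).contDiff.comp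
      (contDiff_fst.comp contDiff_snd))
  have h3 : ContDiff ℝ ∞ (fun q : Euc n × (Euc n × ℝ) => (q.1 - q.2.2 • q.2.1, q.2.1)) := by
    fun_prop
  exact ((h1.pow k).mul (contDiff_prod fun j _ => h2 (I j))).mul (Ψ.smooth.comp h3)

theorem adjointIntegrand_support {n p : ℕ} (k : ℕ) (Ψ : TestFunction n) (I : Fin p → Fin n)
    (r : ℝ) : ∃ A : Set (Euc n × ℝ), IsCompact A ∧
      ∀ x, ‖x‖ < r → ∀ q, q ∉ A → adjointIntegrand k Ψ I x q.1 q.2 = 0 := by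
  have hK : IsCompact (tsupport Ψ.toFun) := Ψ.compact
  obtain ⟨R, hR⟩ := hK.isBounded.exists_norm_le
  obtain ⟨c, hc, hcK⟩ : ∃ c : ℝ, 0 < c ∧ ∀ q ∈ tsupport Ψ.toFun, c ≤ ‖q.2‖ := by
    rcases (tsupport Ψ.toFun).eq_empty_or_nonempty with h | h
    · exact ⟨1, one_pos, by simp [h]⟩
    · obtain ⟨q, hq, hmin⟩ := hK.exists_isMinOn h
        (f := fun q : Euc n × Euc n => ‖q.2‖) (by fun_prop)
      exact ⟨‖q.2‖, norm_pos_iff.2 (Ψ.support_ne q hq), fun y hy => hmin hy⟩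
  refine ⟨Metric.closedBall 0 R ×ˢ Metric.closedBall 0 ((R + r) / c),
    (isCompact_closedBall _ _).prod (isCompact_closedBall _ _), fun x hx q hq => ?_⟩
  by_contra hne
  apply hq
  have hΨ : Ψ.toFun (x - q.2 • q.1, q.1) ≠ 0 := fun h0 => hne (by simp [adjointIntegrand, h0])
  have hmem : (x - q.2 • q.1, q.1) ∈ tsupport Ψ.toFun := subset_tsupport _ hΨ
  have h1 := hR _ hmem
  have h2 := hcK _ hmem
  rw [Prod.norm_def, max_le_iff] at h1
  simp only at h1 h2
  refine ⟨by simpa using h1.2, ?_⟩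
  rw [mem_closedBall_zero_iff, le_div_iff₀ hc]
  have h3 : ‖q.2 • q.1‖ ≤ R + r := by
    have : q.2 • q.1 = x - (x - q.2 • q.1) := by abel
    rw [this]
    linarith [norm_sub_le x (x - q.2 • q.1), h1.1]
  rw [norm_smul] at h3
  exact (mul_le_mul_of_nonneg_left h2 (norm_nonneg _)).trans h3

theorem adjoint_contDiff {n p : ℕ} (ν : Measure (Euc n)) [IsFiniteMeasureOnCompacts ν]
    [SFinite ν] (k : ℕ) (Ψ : TestFunction n) (I : Fin p → Fin n) :
    ContDiff ℝ ∞ (fun x => ∫ ξ, ∫ t, adjointIntegrand k Ψ I x ξ t ∂volume ∂ν) := by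
  have hprod : ∀ x, ∫ ξ, ∫ t, adjointIntegrand k Ψ I x ξ t ∂volume ∂ν =
      ∫ q, adjointIntegrand k Ψ I x q.1 q.2 ∂(ν.prod volume) := by
    intro x
    obtain ⟨A, hA, hA0⟩ := adjointIntegrand_support k Ψ I (‖x‖ + 1)
    have hcont : Continuous (fun q : Euc n × ℝ => adjointIntegrand k Ψ I x q.1 q.2) :=
      (adjointIntegrand_contDiff k Ψ I).continuous.comp
        (Continuous.prodMk continuous_const continuous_id)
    refine (integral_prod _ (hcont.integrable_of_hasCompactSupport ?_)).symm
    exact HasCompactSupport.intro hA fun q hq => hA0 x (by linarith) q hq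
  simp only [hprod]
  rw [contDiff_iff_contDiffAt]
  intro x₀
  obtain ⟨A, hA, hA0⟩ := adjointIntegrand_support k Ψ I (‖x₀‖ + 1)
  let g : Euc n → Euc n × ℝ → ℂ := fun x q => adjointIntegrand k Ψ I x (-q).1 (-q).2
  have hconv := contDiffOn_convolution_right_with_param (𝕜 := ℝ) (μ := ν.prod volume)
    (f := fun _ => (1 : ℝ)) (n := ⊤) (ContinuousLinearMap.lsmul ℝ ℝ) (g := g)
    (s := Metric.ball 0 (‖x₀‖ + 1)) (k := -A) Metric.isOpen_ball hA.neg
    (fun x q hx hq => hA0 x (by simpa using hx) (-q) (by simpa using hq))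
    (locallyIntegrable_const _)
    (((adjointIntegrand_contDiff k Ψ I).comp
      (g := fun q : Euc n × (Euc n × ℝ) =>
        adjointIntegrand k Ψ I q.1 q.2.1 q.2.2)
      (f := fun q : Euc n × (Euc n × ℝ) => (q.1, -q.2)) (by fun_prop)).contDiffOn)
  have hat := (hconv.contDiffAt (x := (x₀, 0)) (by
    apply (Metric.isOpen_ball.prod isOpen_univ).mem_nhds
    simp)).comp x₀ (f := fun x : Euc n => (x, (0 : Euc n × ℝ))) (by fun_prop)
  refine hat.congr_of_eventuallyEq (Filter.Eventually.of_forall fun x => ?_)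
  simp [convolution, g]

/-- The component `i₁ … i_p` of the adjoint momentum ray transform of `Ψ`, the smooth function
`x ↦ ∫_{ℝⁿ} ∫_ℝ t^k ξ^{i₁} ⋯ ξ^{i_p} Ψ(x - t ξ, ξ) dt dν(ξ)`. -/
def momentAdjoint {n p : ℕ} (ν : Measure (Euc n)) [IsFiniteMeasureOnCompacts ν] [SFinite ν]
    (k : ℕ) (Ψ : TestFunction n) (I : Fin p → Fin n) : Smooth n :=
  ⟨fun x => ∫ ξ, ∫ t, adjointIntegrand k Ψ I x ξ t ∂volume ∂ν, adjoint_contDiff ν k Ψ I⟩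

/-- The `k`-th momentum ray transform of `F ∈ ℰ'(𝐒^m)`, as a distribution in `(x, ξ)` with
respect to the measure `dx dν(ξ)`:
`Ψ ↦ ∑_{p=0}^m ∑_{i₁, …, i_p} ⟨f^{(p)}_{i₁ … i_p}, (adjoint transform of Ψ)_{i₁ … i_p}⟩`.
For `ν` the Lebesgue measure this is `I^{m,k} F`. -/
def momentRayTransform {n m : ℕ} (ν : Measure (Euc n)) [IsFiniteMeasureOnCompacts ν] [SFinite ν]
    (k : ℕ) (F : TensorSum n m) (Ψ : TestFunction n) : ℂ :=
  ∑ p : Fin (m + 1), ∑ I : Fin p → Fin n, ((F p).1 I).1 (momentAdjoint ν k Ψ I)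

/-- The surface measure of `𝕊^{n-1}`, as a measure on `ℝⁿ`. -/
def sphereMeasure (n : ℕ) : Measure (Euc n) :=
  (volume : Measure (Euc n)).toSphere.map Subtype.val

instance (n : ℕ) : IsFiniteMeasure (sphereMeasure n) := by
  unfold sphereMeasure
  infer_instance

/-- `J^{m,k} F`, the restriction of `I^{m,k} F` to `ℝⁿ × 𝕊^{n-1}`, as a distribution on the
unit sphere bundle: test functions are paired with `dx dS(ξ)`. -/
def sphereTransform {n m : ℕ} (k : ℕ) (F : TensorSum n m) : TestFunction n → ℂ :=
  momentRayTransform (sphereMeasure n) k F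

/-- `f^{(2M)} = - ∑_{l=1}^{M} i_δ^{M-l+1} f^{(2l-2)}` with `M = [m/2]`
(the summation index is shifted by one). -/
def EvenRelation {n m : ℕ} (F : TensorSum n m) : Prop :=
  F ⟨2 * (m / 2), by omega⟩ =
    -∑ l : Fin (m / 2), iDeltaPowTo (m / 2 - l) (by simp only; omega) (F ⟨2 * l, by omega⟩)

/-- `f^{(2M+1)} = - ∑_{l=1}^{M} i_δ^{M-l+1} f^{(2l-1)}` with `M = [(m-1)/2]`
(the summation index is shifted by one). -/
def OddRelation {n m : ℕ} (hm : 1 ≤ m) (F : TensorSum n m) : Prop :=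
  F ⟨2 * ((m - 1) / 2) + 1, by omega⟩ =
    -∑ l : Fin ((m - 1) / 2),
      iDeltaPowTo ((m - 1) / 2 - l) (by simp only; omega) (F ⟨2 * l + 1, by omega⟩)

end MRT

end

/-!
On unit vectors `i_δ` does not change the form `f_{i₁ … i_p} ξ^{i₁} ⋯ ξ^{i_p}`, so `J^{m,k} F` only
depends on one tensor of even rank and one of odd rank, both of rank at most `m`, and the relations
say that these two vanish.

Conversely, as `∫ t^m ρ(s - t) dt` can be any monomial `s^k` with `k ≤ m`, the transform
`J^{m,m} F` tested on `α(ξ) ρ(x ⬝ ξ) φ(x - (x ⬝ ξ) ξ)` determines all the numbers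
`⟨F_{i…} ξ^{i…}, (x ⬝ ξ)^k exp (i x ⬝ y)⟩` with `|ξ| = 1`, `ξ ⊥ y`, `k ≤ m`. Replacing `ξ` by `-ξ`
separates the two parities. For a single `f` of rank `p ≤ m`, the polynomial
`u ↦ ⟨f_{i…} (η + u y)^{i…}, exp (i x ⬝ y)⟩` with `η ⊥ y` has degree at most `m`, and a Taylor
expansion of the exponential along `η + u y` shows that it vanishes to order `m + 1` at `u = 0`.
As `n ≥ 2`, the vectors `η + u y` are dense, so the Fourier transform of `f` vanishes.
-/

noncomputable section

namespace MRT

open scoped FourierTransform SchwartzMap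

section ParametricIntegrals

variable {Y E F : Type*} [TopologicalSpace Y] [MeasurableSpace Y]
  [NormedAddCommGroup E] [NormedSpace ℝ E] [NormedAddCommGroup F] [NormedSpace ℝ F]
  {ν : Measure Y} {Φ : Y → E → F}

/-- Evaluation of a multilinear map at all but its first argument, as a continuous linear map. -/
def applyTail {j : ℕ} (w : Fin j → E) : (E [×(j + 1)]→L[ℝ] F) →L[ℝ] E →L[ℝ] F :=
  LinearMap.mkContinuous₂
    (LinearMap.mk₂ ℝ (fun D v => D (Fin.cons v w)) (fun _ _ _ => rfl) (fun _ _ _ => rfl)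
      (fun D => D.cons_add w)
      (fun c D => D.cons_smul w c)) (∏ i, ‖w i‖)
    fun D v => (D.le_opNorm _).trans_eq (by
      simp only [Fin.prod_univ_succ, Fin.cons_zero, Fin.cons_succ]
      ring)

theorem applyTail_apply {j : ℕ} (w : Fin j → E) (D : E [×(j + 1)]→L[ℝ] F) (v : E) :
    applyTail w D v = D (Fin.cons v w) :=
  rfl

theorem hasFDerivAt_iteratedFDeriv_apply {f : E → F} (hf : ContDiff ℝ ∞ f) {j : ℕ}
    (w : Fin j → E) (x : E) :
    HasFDerivAt (fun z => iteratedFDeriv ℝ j f z w) (applyTail w (iteratedFDeriv ℝ (j + 1) f x))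
      x := by
  have hdiff := (hf.differentiable_iteratedFDeriv (by exact_mod_cast ENat.natCast_lt_top j)) x
  exact (ContinuousMultilinearMap.apply ℝ (fun _ : Fin j => E) F w).hasFDerivAt.comp x
    hdiff.hasFDerivAt

/-- A family of smooth functions whose derivatives of each order depend continuously on the
parameter and are dominated, uniformly on bounded sets, by an integrable function of the parameter:
such a family can be differentiated under the integral sign to all orders. -/
structure IsDominatedSmoothFamily (ν : Measure Y) (Φ : Y → E → F) : Prop where
  contDiff : ∀ y, ContDiff ℝ ∞ (Φ y)
  continuous_iteratedFDeriv : ∀ j, Continuous fun q : Y × E => iteratedFDeriv ℝ j (Φ q.1) q.2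
  exists_bound : ∀ (R : ℝ) (j : ℕ), ∃ b : Y → ℝ, Integrable b ν ∧
    ∀ y x, ‖x‖ ≤ R → ‖iteratedFDeriv ℝ j (Φ y) x‖ ≤ b y

namespace IsDominatedSmoothFamily

theorem continuous_left (h : IsDominatedSmoothFamily ν Φ) (j : ℕ) (x : E) :
    Continuous fun y => iteratedFDeriv ℝ j (Φ y) x :=
  (h.continuous_iteratedFDeriv j).comp (.prodMk_left x)

variable [SecondCountableTopology Y] [OpensMeasurableSpace Y]

theorem integrable (h : IsDominatedSmoothFamily ν Φ) (j : ℕ) (x : E) :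
    Integrable (fun y => iteratedFDeriv ℝ j (Φ y) x) ν := by
  obtain ⟨b, hb, hΦb⟩ := h.exists_bound ‖x‖ j
  exact hb.mono' (h.continuous_left j x).aestronglyMeasurable (.of_forall fun y => hΦb y x le_rfl)

theorem hasFDerivAt_integral_iteratedFDeriv_apply [CompleteSpace F]
    (h : IsDominatedSmoothFamily ν Φ) {j : ℕ} (w : Fin j → E) (x : E) :
    HasFDerivAt (fun z => ∫ y, iteratedFDeriv ℝ j (Φ y) z w ∂ν)
      (applyTail w (∫ y, iteratedFDeriv ℝ (j + 1) (Φ y) x ∂ν)) x := by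
  obtain ⟨b, hb, hΦb⟩ := h.exists_bound (‖x‖ + 1) (j + 1)
  have hint : ∀ z, Integrable (fun y => iteratedFDeriv ℝ j (Φ y) z w) ν := fun z =>
    (ContinuousMultilinearMap.apply ℝ (fun _ : Fin j => E) F w).integrable_comp (h.integrable j z)
  rw [← (applyTail w).integral_comp_comm (h.integrable (j + 1) x)]
  refine hasFDerivAt_integral_of_dominated_of_fderiv_le
    (bound := fun y => ‖applyTail (F := F) w‖ * b y)
    (F' := fun z y => applyTail w (iteratedFDeriv ℝ (j + 1) (Φ y) z))
    (Metric.ball_mem_nhds x one_pos) (.of_forall fun z => (hint z).aestronglyMeasurable) (hint x)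
    ((applyTail w).integrable_comp (h.integrable (j + 1) x)).aestronglyMeasurable
    (.of_forall fun y z hz => (applyTail w).le_opNorm_of_le (hΦb y z ?_)) (hb.const_mul _)
    (.of_forall fun y z _ => hasFDerivAt_iteratedFDeriv_apply (h.contDiff y) w z)
  linarith [norm_sub_norm_le z x, mem_ball_iff_norm.1 hz]

theorem iteratedFDeriv_integral [CompleteSpace F] (h : IsDominatedSmoothFamily ν Φ)
    (hsmooth : ContDiff ℝ ∞ fun x => ∫ y, Φ y x ∂ν) (j : ℕ) (x : E) :
    iteratedFDeriv ℝ j (fun x => ∫ y, Φ y x ∂ν) x = ∫ y, iteratedFDeriv ℝ j (Φ y) x ∂ν := by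
  induction j generalizing x with
  | zero =>
    ext v
    rw [ContinuousMultilinearMap.integral_apply (h.integrable 0 x)]
    simp only [iteratedFDeriv_zero_apply]
  | succ j ih =>
    ext v
    have hderiv := h.hasFDerivAt_integral_iteratedFDeriv_apply (Fin.tail v) x
    simp only [← ContinuousMultilinearMap.integral_apply (h.integrable j _), ← ih] at hderiv
    have huniq := (hasFDerivAt_iteratedFDeriv_apply hsmooth (Fin.tail v) x).unique hderiv
    simpa only [applyTail_apply, Fin.cons_self_tail] using DFunLike.congr_fun huniq (v 0)

end IsDominatedSmoothFamily

variable {V : Type*} [NormedAddCommGroup V] [NormedSpace ℝ V] {Ψ : V × E → F}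

theorem continuous_iteratedFDeriv_right (hΨ : ContDiff ℝ ∞ Ψ) (j : ℕ) :
    Continuous fun q : V × E => iteratedFDeriv ℝ j (fun x => Ψ (q.1, x)) q.2 := by
  have hcomp : ∀ q : V × E, iteratedFDeriv ℝ j (fun x => Ψ (q.1, x)) q.2 =
      (iteratedFDeriv ℝ j Ψ q).compContinuousLinearMap
        (fun _ => ContinuousLinearMap.inr ℝ V E) := by
    intro q
    have htranslate : (fun x => Ψ (q.1, x)) =
        (fun z => Ψ (z + (q.1, 0))) ∘ ContinuousLinearMap.inr ℝ V E := by
      funext x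
      simp
    have hsmooth : ContDiff ℝ ∞ fun z => Ψ (z + (q.1, 0)) :=
      hΨ.comp (contDiff_id.add contDiff_const)
    rw [htranslate, ContinuousLinearMap.iteratedFDeriv_comp_right _ hsmooth _
      (by exact_mod_cast le_top), iteratedFDeriv_comp_add_right]
    simp
  simp only [hcomp]
  exact (ContinuousMultilinearMap.compContinuousLinearMapL
    (fun _ : Fin j => ContinuousLinearMap.inr ℝ V E)).continuous.comp
    (hΨ.continuous_iteratedFDeriv (by exact_mod_cast le_top))

theorem isDominatedSmoothFamily_of_compact [MeasurableSpace V] [OpensMeasurableSpace V]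
    [ProperSpace E] (ν : Measure V) [IsFiniteMeasureOnCompacts ν] (hΨ : ContDiff ℝ ∞ Ψ)
    (hsupp : ∀ R : ℝ, ∃ A : Set V, IsCompact A ∧ ∀ x, ‖x‖ < R → ∀ y ∉ A, Ψ (y, x) = 0) :
    IsDominatedSmoothFamily ν fun y x => Ψ (y, x) where
  contDiff y := hΨ.comp (contDiff_const.prodMk contDiff_id)
  continuous_iteratedFDeriv := continuous_iteratedFDeriv_right hΨ
  exists_bound R j := by
    obtain ⟨A, hA, hΨA⟩ := hsupp (R + 1)
    obtain ⟨M, hM⟩ := (hA.prod (isCompact_closedBall (0 : E) R)).exists_bound_of_continuousOn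
      (continuous_iteratedFDeriv_right hΨ j).continuousOn
    refine ⟨A.indicator fun _ => M, (integrable_indicator_iff hA.measurableSet).2
      (integrableOn_const hA.measure_lt_top.ne), fun y x hx => ?_⟩
    by_cases hy : y ∈ A
    · rw [Set.indicator_of_mem hy]
      exact hM (y, x) ⟨hy, by simpa using hx⟩
    · have hzero : (fun x => Ψ (y, x)) =ᶠ[nhds x] 0 := by
        filter_upwards [Metric.ball_mem_nhds x one_pos] with z hz
        exact hΨA z (by linarith [norm_sub_norm_le z x, mem_ball_iff_norm.1 hz]) y hy
      rw [Set.indicator_of_notMem hy, (hzero.iteratedFDeriv ℝ j).eq_of_nhds]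
      simp

end ParametricIntegrals

section Pairing

theorem norm_le_of_forall_mem_closedBall {ι E F : Type*} [Fintype ι] [NormedAddCommGroup E]
    [NormedSpace ℝ E] [NormedAddCommGroup F] [NormedSpace ℝ F]
    {D : ContinuousMultilinearMap ℝ (fun _ : ι => E) F} {C : ℝ} (hC : 0 ≤ C)
    (h : ∀ v : ι → Metric.closedBall (0 : E) 1, ‖D fun i => v i‖ ≤ C) : ‖D‖ ≤ C := by
  refine ContinuousMultilinearMap.opNorm_le_bound hC fun v => ?_
  have hunit : ∀ i, ‖v i‖⁻¹ • v i ∈ Metric.closedBall (0 : E) 1 := fun i => by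
    rw [mem_closedBall_zero_iff, norm_smul, norm_inv, norm_norm]
    exact inv_mul_le_one
  have hv : v = fun i => ‖v i‖ • ‖v i‖⁻¹ • v i := funext fun i => by
    rcases eq_or_ne (v i) 0 with hi | hi
    · simp only [hi, smul_zero]
    · rw [smul_inv_smul₀ (norm_ne_zero_iff.2 hi)]
  calc ‖D v‖ = (∏ i, ‖v i‖) * ‖D fun i => ‖v i‖⁻¹ • v i‖ := by
        conv_lhs => rw [hv, D.map_smul_univ]
        rw [norm_smul, norm_prod]
        simp only [norm_norm]
    _ ≤ (∏ i, ‖v i‖) * C := by gcongr; exact h fun i => ⟨_, hunit i⟩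
    _ = C * ∏ i, ‖v i‖ := mul_comm _ _

theorem exists_strongDual_comp_eq {𝕜 M E : Type*} [RCLike 𝕜] [AddCommGroup M] [Module 𝕜 M]
    [SeminormedAddCommGroup E] [NormedSpace 𝕜 E] (T : M →ₗ[𝕜] 𝕜) (L : M →ₗ[𝕜] E) {C : ℝ}
    (hT : ∀ x, ‖T x‖ ≤ C * ‖L x‖) : ∃ S : StrongDual 𝕜 E, ∀ x, T x = S (L x) := by
  obtain ⟨g, hg⟩ : T ∈ LinearMap.range L.dualMap := by
    rw [LinearMap.range_dualMap_eq_dualAnnihilator_ker, Submodule.mem_dualAnnihilator]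
    intro x hx
    simpa only [LinearMap.mem_ker.1 hx, norm_zero, mul_zero, norm_le_zero_iff] using hT x
  have hg : ∀ x, g (L x) = T x := fun x => LinearMap.congr_fun hg x
  let gRange : LinearMap.range L →ₗ[𝕜] 𝕜 := g.domRestrict _
  have hbound : ∀ y, ‖gRange y‖ ≤ C * ‖y‖ := by
    rintro ⟨_, x, rfl⟩
    exact (congrArg norm (hg x)).trans_le (hT x)
  obtain ⟨S, hS, -⟩ := exists_extension_norm_eq _ (gRange.mkContinuous C hbound)
  exact ⟨S, fun x => (hg x).symm.trans (hS ⟨L x, x, rfl⟩).symm⟩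

variable {n : ℕ}

theorem contDiffAt_smooth (φ : Smooth n) (j : ℕ) (x : Euc n) : ContDiffAt ℝ j φ.1 x :=
  (ContDiff.of_le (n := ∞) φ.2 (by exact_mod_cast le_top)).contDiffAt

theorem continuous_iteratedFDeriv_apply {Y : Type*} [TopologicalSpace Y] {Φ : Y → Smooth n}
    (hΦ : ∀ j, Continuous fun q : Y × Euc n => iteratedFDeriv ℝ j (Φ q.1).1 q.2) (j : ℕ) :
    Continuous fun q : Y × Euc n × (Fin j → Euc n) =>
      iteratedFDeriv ℝ j (Φ q.1).1 q.2.1 q.2.2 :=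
  ((hΦ j).comp (by fun_prop : Continuous fun q : Y × Euc n × (Fin j → Euc n) =>
    (q.1, q.2.1))).eval (by fun_prop)

/-- The normed space through which a distribution of order `N` supported in a compact set `K`
factors: continuous functions of a point of `K` and of `j ≤ N` vectors of the unit ball. Recording
derivatives by their values on the unit ball keeps all functions scalar. -/
abbrev JetSpace (n : ℕ) (K : Set (Euc n)) (N : ℕ) : Type :=
  (j : Fin (N + 1)) → C(K × (Fin j → Metric.closedBall (0 : Euc n) 1), ℂ)

variable (K : Set (Euc n)) (N : ℕ)

/-- The derivatives of order at most `N` of a smooth function, over `K`. -/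
def jet : Smooth n →ₗ[ℂ] JetSpace n K N where
  toFun φ j := ⟨fun q => iteratedFDeriv ℝ j φ.1 q.1 fun i => q.2 i, by
    have hφ : ∀ j, Continuous fun q : Unit × Euc n => iteratedFDeriv ℝ j φ.1 q.2 := fun j =>
      (ContDiff.continuous_iteratedFDeriv (n := ∞) (by exact_mod_cast le_top) φ.2).comp
        continuous_snd
    exact (continuous_iteratedFDeriv_apply (Φ := fun _ => φ) hφ j).comp
      (f := fun q : K × (Fin j → Metric.closedBall (0 : Euc n) 1) =>
        ((), (q.1 : Euc n), fun i => (q.2 i : Euc n))) (by fun_prop)⟩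
  map_add' φ ψ := by
    funext j
    ext1 q
    exact congrArg (fun D => D fun i => (q.2 i : Euc n))
      (iteratedFDeriv_add_apply (contDiffAt_smooth φ j q.1) (contDiffAt_smooth ψ j q.1))
  map_smul' c φ := by
    funext j
    ext1 q
    exact congrArg (fun D : Euc n [×j]→L[ℝ] ℂ => D fun i => (q.2 i : Euc n))
      (iteratedFDeriv_const_smul_apply (contDiffAt_smooth φ j q.1))

variable {K N}

theorem norm_iteratedFDeriv_le_norm_jet [CompactSpace K] (φ : Smooth n) (j : Fin (N + 1))
    {x : Euc n} (hx : x ∈ K) : ‖iteratedFDeriv ℝ j φ.1 x‖ ≤ ‖jet K N φ‖ :=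
  norm_le_of_forall_mem_closedBall (norm_nonneg _) fun v =>
    ((jet K N φ j).norm_coe_le_norm (⟨x, hx⟩, v)).trans (norm_le_pi_norm (jet K N φ) j)

theorem norm_jet_apply_le [CompactSpace K] {φ : Smooth n} {j : Fin (N + 1)} {B : ℝ} (hB : 0 ≤ B)
    (h : ∀ x ∈ K, ‖iteratedFDeriv ℝ j φ.1 x‖ ≤ B) : ‖jet K N φ j‖ ≤ B := by
  refine (ContinuousMap.norm_le _ hB).2 fun q => ?_
  calc ‖iteratedFDeriv ℝ j φ.1 q.1 fun i => q.2 i‖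
      ≤ ‖iteratedFDeriv ℝ j φ.1 q.1‖ * ∏ i, ‖(q.2 i : Euc n)‖ :=
        ContinuousMultilinearMap.le_opNorm _ _
    _ ≤ B * 1 := by
        gcongr
        · exact h q.1 q.1.2
        · exact Finset.prod_le_one (fun i _ => norm_nonneg _) fun i _ =>
            mem_closedBall_zero_iff.1 (q.2 i).2
    _ = B := mul_one B

theorem continuous_jet {Y : Type*} [TopologicalSpace Y] {Φ : Y → Smooth n}
    (hΦ : ∀ j, Continuous fun q : Y × Euc n => iteratedFDeriv ℝ j (Φ q.1).1 q.2)
    [CompactSpace K] : Continuous fun y => jet K N (Φ y) := by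
  refine continuous_pi fun j => ?_
  let G : C(Y × (K × (Fin j → Metric.closedBall (0 : Euc n) 1)), ℂ) :=
    ⟨fun q => iteratedFDeriv ℝ j (Φ q.1).1 q.2.1 fun i => q.2.2 i,
      (continuous_iteratedFDeriv_apply hΦ j).comp
        (f := fun q : Y × (K × (Fin j → Metric.closedBall (0 : Euc n) 1)) =>
          (q.1, (q.2.1 : Euc n), fun i => (q.2.2 i : Euc n))) (by fun_prop)⟩
  exact G.curry.continuous

theorem exists_jet_functional (T : CompactDistribution n) :
    ∃ (K : Set (Euc n)) (N : ℕ) (_ : CompactSpace K) (S : StrongDual ℂ (JetSpace n K N)),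
      ∀ φ, T.1 φ = S (jet K N φ) := by
  obtain ⟨K, N, C, hK, _, hT⟩ := T.2
  have hKcompact : CompactSpace K := isCompact_iff_compactSpace.1 hK
  obtain ⟨S, hS⟩ := exists_strongDual_comp_eq T.1 (jet K N) (C := C) fun φ =>
    hT φ _ (norm_nonneg _) fun j hj x hx =>
      norm_iteratedFDeriv_le_norm_jet φ ⟨j, Nat.lt_succ_of_le hj⟩ hx
  exact ⟨K, N, hKcompact, S, hS⟩

theorem continuous_pairing (T : CompactDistribution n) {Y : Type*} [TopologicalSpace Y]
    {Φ : Y → Smooth n}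
    (hΦ : ∀ j, Continuous fun q : Y × Euc n => iteratedFDeriv ℝ j (Φ q.1).1 q.2) :
    Continuous fun y => T.1 (Φ y) := by
  obtain ⟨K, N, _, S, hS⟩ := exists_jet_functional T
  simp only [hS]
  exact S.continuous.comp (continuous_jet hΦ)

theorem pairing_integral (T : CompactDistribution n) {Y : Type*} [TopologicalSpace Y]
    [SecondCountableTopology Y] [MeasurableSpace Y] [OpensMeasurableSpace Y] {ν : Measure Y}
    {Φ : Y → Smooth n} (hΦ : IsDominatedSmoothFamily ν fun y => (Φ y).1) {φ : Smooth n}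
    (hφ : ∀ x, φ.1 x = ∫ y, (Φ y).1 x ∂ν) : T.1 φ = ∫ y, T.1 (Φ y) ∂ν := by
  obtain ⟨K, N, hK, S, hS⟩ := exists_jet_functional T
  obtain ⟨R, hR⟩ := (isCompact_iff_compactSpace.2 hK).isBounded.exists_norm_le
  have hint : ∀ j : Fin (N + 1), Integrable (fun y => jet K N (Φ y) j) ν := by
    intro j
    obtain ⟨b, hb, hΦb⟩ := hΦ.exists_bound R j
    have hcont : Continuous fun y => jet K N (Φ y) j :=
      (continuous_apply j).comp (continuous_jet hΦ.continuous_iteratedFDeriv)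
    refine hb.norm.mono' hcont.aestronglyMeasurable (.of_forall fun y => ?_)
    exact norm_jet_apply_le (norm_nonneg _) fun x hx =>
      (hΦb y x (hR x hx)).trans (Real.le_norm_self _)
  have hjet : jet K N φ = ∫ y, jet K N (Φ y) ∂ν := by
    funext j
    ext1 q
    rw [eval_integral hint, ContinuousMap.integral_apply (hint j)]
    have hφ' : φ.1 = fun x => ∫ y, (Φ y).1 x ∂ν := funext hφ
    have hderiv := hΦ.iteratedFDeriv_integral (hφ' ▸ φ.2) j q.1
    rw [← hφ'] at hderiv
    exact (congrArg (fun D : Euc n [×j]→L[ℝ] ℂ => D fun i => (q.2 i : Euc n)) hderiv).trans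
      (ContinuousMultilinearMap.integral_apply (hΦ.integrable j q.1) _)
  simp only [hS, hjet]
  exact (S.integral_comp_comm (Integrable.of_eval hint)).symm

theorem exists_pairing_eq_of_eqOn_ball (T : CompactDistribution n) :
    ∃ R : ℝ, ∀ φ ψ : Smooth n, (∀ x, ‖x‖ < R → φ.1 x = ψ.1 x) → T.1 φ = T.1 ψ := by
  obtain ⟨K, N, hK, S, hS⟩ := exists_jet_functional T
  obtain ⟨R, hR⟩ := (isCompact_iff_compactSpace.2 hK).isBounded.exists_norm_le
  refine ⟨R + 1, fun φ ψ h => ?_⟩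
  rw [hS, hS]
  congr 1
  funext j
  ext1 q
  have hq : (q.1 : Euc n) ∈ Metric.ball (0 : Euc n) (R + 1) :=
    mem_ball_zero_iff.2 ((hR _ q.1.2).trans_lt (lt_add_one R))
  have heq : φ.1 =ᶠ[nhds (q.1 : Euc n)] ψ.1 := by
    filter_upwards [Metric.isOpen_ball.mem_nhds hq] with z hz
    exact h z (mem_ball_zero_iff.1 hz)
  exact congrArg (fun D => D fun i => (q.2 i : Euc n)) (heq.iteratedFDeriv ℝ j).eq_of_nhds

/-- The smooth function `x ↦ Φ (y, x)`. -/
def slice {V : Type*} [NormedAddCommGroup V] [NormedSpace ℝ V] {Φ : V × Euc n → ℂ}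
    (hΦ : ContDiff ℝ ∞ Φ) (y : V) : Smooth n :=
  ⟨fun x => Φ (y, x), hΦ.comp (contDiff_const.prodMk contDiff_id)⟩

theorem continuous_pairing_slice (T : CompactDistribution n) {V : Type*} [NormedAddCommGroup V]
    [NormedSpace ℝ V] {Φ : V × Euc n → ℂ} (hΦ : ContDiff ℝ ∞ Φ) :
    Continuous fun y => T.1 (slice hΦ y) :=
  continuous_pairing T (continuous_iteratedFDeriv_right hΦ)

end Pairing

section PlaneWaves

variable {n : ℕ}

theorem exists_hasCompactSupport_eq_on_ball (φ : Smooth n) (R : ℝ) :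
    ∃ ψ : Smooth n, HasCompactSupport ψ.1 ∧ ∀ x, ‖x‖ < R → ψ.1 x = φ.1 x := by
  let χ : ContDiffBump (0 : Euc n) := ⟨max R 1, max R 1 + 1, by positivity, by linarith⟩
  have hχ : ContDiff ℝ ∞ fun x => (χ x : ℂ) := Complex.ofRealCLM.contDiff.comp χ.contDiff
  refine ⟨⟨fun x => (χ x : ℂ) * φ.1 x, hχ.mul φ.2⟩, HasCompactSupport.mul_right
    (χ.hasCompactSupport.comp_left (g := fun r : ℝ => (r : ℂ)) Complex.ofReal_zero),
    fun x hx => ?_⟩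
  have hx1 : χ x = 1 := χ.one_of_mem_closedBall
    (mem_closedBall_zero_iff.2 (hx.le.trans (le_max_left _ _)))
  simp only [hx1, Complex.ofReal_one, one_mul]

theorem contDiff_ofReal_inner :
    ContDiff ℝ ∞ fun q : Euc n × Euc n => ((inner ℝ q.1 q.2 : ℝ) : ℂ) :=
  Complex.ofRealCLM.contDiff.comp (contDiff_fst.inner ℝ contDiff_snd)

/-- The plane wave `x ↦ exp (i x ⬝ y)`. -/
def planeWave (y : Euc n) : Smooth n :=
  ⟨fun x => Complex.exp (Complex.I * (inner ℝ x y : ℝ)),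
    (contDiff_const.mul (contDiff_ofReal_inner.comp (contDiff_id.prodMk contDiff_const))).cexp⟩

theorem contDiff_planeWave :
    ContDiff ℝ ∞ fun q : Euc n × Euc n => (planeWave q.1).1 q.2 :=
  (contDiff_const.mul (contDiff_ofReal_inner.comp (contDiff_snd.prodMk contDiff_fst))).cexp

theorem iteratedDeriv_cexp_I_mul_ofReal (j : ℕ) :
    iteratedDeriv j (fun t : ℝ => Complex.exp (Complex.I * t)) =
      fun t : ℝ => Complex.I ^ j * Complex.exp (Complex.I * t) := by
  induction j with
  | zero => simp
  | succ j ih =>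
    rw [iteratedDeriv_succ, ih]
    funext t
    have hlin : HasDerivAt (fun t : ℝ => Complex.I * (t : ℂ)) Complex.I t := by
      simpa using (Complex.ofRealCLM.hasDerivAt (x := t)).const_mul Complex.I
    rw [(hlin.cexp.const_mul (Complex.I ^ j)).deriv]
    ring

theorem norm_iteratedFDeriv_planeWave_le (y : Euc n) (j : ℕ) (x : Euc n) :
    ‖iteratedFDeriv ℝ j (planeWave y).1 x‖ ≤ ‖y‖ ^ j := by
  have hexp : ContDiff ℝ ∞ fun t : ℝ => Complex.exp (Complex.I * t) :=
    (contDiff_const.mul Complex.ofRealCLM.contDiff).cexp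
  have hcomp : (planeWave y).1 = (fun t : ℝ => Complex.exp (Complex.I * t)) ∘ innerSL ℝ y := by
    funext x
    simp [planeWave, real_inner_comm]
  rw [hcomp, ContinuousLinearMap.iteratedFDeriv_comp_right _ hexp _ (by exact_mod_cast le_top)]
  refine (ContinuousMultilinearMap.norm_compContinuousLinearMap_le _ _).trans ?_
  rw [norm_iteratedFDeriv_eq_norm_iteratedDeriv, iteratedDeriv_cexp_I_mul_ofReal]
  simp [Complex.norm_exp]

theorem contDiff_smul_planeWave {g : Euc n → ℂ} (hg : ContDiff ℝ ∞ g) (r : ℝ) :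
    ContDiff ℝ ∞ fun q : Euc n × Euc n => (g q.1 • planeWave (r • q.1)).1 q.2 :=
  (hg.comp contDiff_fst).mul
    (ContDiff.comp (g := fun q : Euc n × Euc n => (planeWave q.1).1 q.2)
      (f := fun q : Euc n × Euc n => (r • q.1, q.2)) contDiff_planeWave
      ((contDiff_fst.const_smul r).prodMk contDiff_snd))

theorem isDominatedSmoothFamily_smul_planeWave (g : 𝓢(Euc n, ℂ)) :
    IsDominatedSmoothFamily volume fun v => (g v • planeWave ((2 * Real.pi) • v)).1 where
  contDiff v := (g v • planeWave ((2 * Real.pi) • v)).2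
  continuous_iteratedFDeriv := continuous_iteratedFDeriv_right
    (contDiff_smul_planeWave g.smooth' (2 * Real.pi))
  exists_bound R j := by
    refine ⟨fun v => (2 * Real.pi) ^ j * (‖v‖ ^ j * ‖g v‖),
      (g.integrable_pow_mul volume j).const_mul _, fun v x _ => ?_⟩
    calc ‖iteratedFDeriv ℝ j (g v • planeWave ((2 * Real.pi) • v)).1 x‖
        = ‖g v‖ * ‖iteratedFDeriv ℝ j (planeWave ((2 * Real.pi) • v)).1 x‖ := by
          rw [Submodule.coe_smul, iteratedFDeriv_const_smul_apply (contDiffAt_smooth _ j x),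
            norm_smul]
      _ ≤ ‖g v‖ * ‖(2 * Real.pi) • v‖ ^ j := by
          gcongr
          exact norm_iteratedFDeriv_planeWave_le _ j x
      _ = (2 * Real.pi) ^ j * (‖v‖ ^ j * ‖g v‖) := by
          rw [norm_smul, Real.norm_of_nonneg (by positivity)]
          ring

theorem schwartzMap_eq_integral_planeWave (g : 𝓢(Euc n, ℂ)) (x : Euc n) :
    g x = ∫ v, ((𝓕 g : 𝓢(Euc n, ℂ)) v • planeWave ((2 * Real.pi) • v)).1 x := by
  have hinv : (𝓕⁻ (𝓕 g : 𝓢(Euc n, ℂ)) : 𝓢(Euc n, ℂ)) x = g x := by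
    rw [FourierPair.fourierInv_fourier_eq g]
  rw [SchwartzMap.fourierInv_coe, Real.fourierInv_eq'] at hinv
  refine hinv.symm.trans (integral_congr_ae (.of_forall fun v => ?_))
  simp only [smul_eq_mul, planeWave, Submodule.coe_smul, Pi.smul_apply, inner_smul_right,
    real_inner_comm v x]
  rw [mul_comm, mul_comm Complex.I]

theorem eq_zero_of_forall_planeWave (T : CompactDistribution n)
    (h : ∀ y, T.1 (planeWave y) = 0) : T = 0 := by
  obtain ⟨R, hR⟩ := exists_pairing_eq_of_eqOn_ball T
  ext φ
  obtain ⟨ψ, hψ, hψφ⟩ := exists_hasCompactSupport_eq_on_ball φ R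
  let g : 𝓢(Euc n, ℂ) := hψ.toSchwartzMap ψ.2
  calc T.1 φ = T.1 ψ := (hR ψ φ hψφ).symm
    _ = ∫ v, T.1 ((𝓕 g : 𝓢(Euc n, ℂ)) v • planeWave ((2 * Real.pi) • v)) :=
        pairing_integral T (isDominatedSmoothFamily_smul_planeWave _)
          (schwartzMap_eq_integral_planeWave g)
    _ = 0 := by simp only [map_smul, h, smul_zero, integral_zero]

end PlaneWaves

section SymmetricForms

variable {ι κ R : Type*} [Fintype κ]

/-- The multidegree of the monomial `∏ j, X (I j)`. -/
def multidegree (I : κ → ι) : ι →₀ ℕ := ∑ j, Finsupp.single (I j) 1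

theorem exists_perm_of_multidegree_eq {I J : κ → ι} (h : multidegree I = multidegree J) :
    ∃ π : Equiv.Perm κ, I = J ∘ π := by
  classical
  have hcard : ∀ i, Fintype.card {a // I a = i} = Fintype.card {b // J b = i} := by
    intro i
    simpa [multidegree, Finsupp.finsetSum_apply, Finsupp.single_apply, Fintype.card_subtype]
      using DFunLike.congr_fun h i
  exact ⟨Equiv.ofFiberEquiv fun i => Fintype.equivOfCardEq (hcard i),
    funext fun a => (Equiv.ofFiberEquiv_map _ a).symm⟩

theorem eval_monomial_multidegree [CommSemiring R] (I : κ → ι) (c : R) (x : ι → R) :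
    MvPolynomial.eval x (MvPolynomial.monomial (multidegree I) c) = (∏ j, x (I j)) * c := by
  rw [MvPolynomial.eval_monomial, mul_comm, multidegree,
    ← Finsupp.prod_finsetSum_index (by simp) (by intros; simp [pow_add])]
  simp

theorem eq_zero_of_symmetric_of_form_eq_zero [DecidableEq κ] [Fintype ι] [CommRing R] [IsDomain R]
    [CharZero R] {c : (κ → ι) → R} (hc : ∀ (π : Equiv.Perm κ) (I : κ → ι), c (I ∘ π) = c I)
    {S : Set R} (hS : S.Infinite)
    (h : ∀ x : ι → R, (∀ i, x i ∈ S) → ∑ I, (∏ j, x (I j)) * c I = 0) : c = 0 := by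
  classical
  have hform : ∑ I, MvPolynomial.monomial (multidegree I) (c I) = 0 := by
    refine MvPolynomial.funext_set (fun _ => S) (fun _ => hS) fun x hx => ?_
    simp only [map_sum, eval_monomial_multidegree, map_zero]
    exact h x fun i => hx i (Set.mem_univ i)
  funext I₀
  have hterm : ∀ I, (if multidegree I = multidegree I₀ then c I else 0) =
      (if multidegree I = multidegree I₀ then 1 else 0) * c I₀ := by
    intro I
    split_ifs with hI
    · obtain ⟨π, rfl⟩ := exists_perm_of_multidegree_eq hI
      rw [hc, one_mul]
    · rw [zero_mul]
  have hcoeff := congrArg (MvPolynomial.coeff (multidegree I₀)) hform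
  simp only [MvPolynomial.coeff_sum, MvPolynomial.coeff_monomial, MvPolynomial.coeff_zero,
    hterm, ← Finset.sum_mul, Finset.sum_boole] at hcoeff
  exact (mul_eq_zero.1 hcoeff).resolve_left
    (Nat.cast_ne_zero.2 (Finset.card_ne_zero_of_mem (a := I₀) (by simp)))

end SymmetricForms

section Contraction

variable {n p q m : ℕ}

/-- The full contraction `f_{i₁ … i_p} ξ^{i₁} ⋯ ξ^{i_p}` of a tensor field with a fixed vector. -/
def contract (ξ : Euc n) : SymTensor n p →ₗ[ℂ] CompactDistribution n where
  toFun f := ∑ I : Fin p → Fin n, (∏ j, (ξ (I j) : ℂ)) • f.1 I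
  map_add' f g := by simp only [Submodule.coe_add, Pi.add_apply, smul_add, Finset.sum_add_distrib]
  map_smul' c f := by
    simp only [Submodule.coe_smul, Pi.smul_apply, smul_comm _ c, Finset.smul_sum, RingHom.id_apply]

theorem contract_apply (ξ : Euc n) (f : SymTensor n p) (φ : Smooth n) :
    (contract ξ f).1 φ = ∑ I : Fin p → Fin n, (∏ j, (ξ (I j) : ℂ)) * (f.1 I).1 φ := by
  simp only [contract, LinearMap.coe_mk, AddHom.coe_mk, Submodule.coe_sum, Submodule.coe_smul,
    LinearMap.sum_apply, LinearMap.smul_apply, smul_eq_mul]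

theorem contract_smul (c : ℝ) (ξ : Euc n) (f : SymTensor n p) :
    contract (c • ξ) f = (c : ℂ) ^ p • contract ξ f := by
  simp only [contract, LinearMap.coe_mk, AddHom.coe_mk, PiLp.smul_apply, smul_eq_mul,
    Complex.ofReal_mul, Finset.prod_mul_distrib, Finset.prod_const, Finset.card_univ,
    Fintype.card_fin, mul_smul, Finset.smul_sum]

theorem eq_zero_of_forall_contract_eq_zero {f : SymTensor n p} (h : ∀ ξ, contract ξ f = 0) :
    f = 0 := by
  refine Subtype.ext (funext fun I => ?_)
  ext φ
  refine congrFun (eq_zero_of_symmetric_of_form_eq_zero (c := fun I => (f.1 I).1 φ)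
    (fun π I => by rw [f.2 π I])
    (Set.infinite_range_of_injective Complex.ofReal_injective) fun x hx => ?_) I
  choose ξ hξ using hx
  simpa only [contract_apply, hξ, Submodule.coe_zero, LinearMap.zero_apply] using
    congrArg (fun T => T.1 φ) (h (WithLp.toLp 2 ξ))

theorem continuous_contract_pairing (f : SymTensor n p) {Y : Type*} [TopologicalSpace Y]
    {ξ : Y → Euc n} (hξ : Continuous ξ) {Φ : Y → Smooth n}
    (hΦ : ∀ j, Continuous fun q : Y × Euc n => iteratedFDeriv ℝ j (Φ q.1).1 q.2) :
    Continuous fun y => (contract (ξ y) f).1 (Φ y) := by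
  simp only [contract_apply]
  refine continuous_finsetSum _ fun I _ => Continuous.mul ?_ (continuous_pairing _ hΦ)
  fun_prop

theorem exists_polynomial_eval_eq_contract (f : SymTensor n p) (φ : Smooth n) (η y : Euc n) :
    ∃ Q : Polynomial ℂ, Q.natDegree ≤ p ∧
      ∀ u : ℝ, Q.eval (u : ℂ) = (contract (η + u • y) f).1 φ := by
  refine ⟨∑ I : Fin p → Fin n, (∏ j, (Polynomial.C (η (I j) : ℂ) +
    Polynomial.C (y (I j) : ℂ) * Polynomial.X)) * Polynomial.C ((f.1 I).1 φ), ?_, fun u => ?_⟩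
  · refine Polynomial.natDegree_sum_le_of_forall_le _ _ fun I _ => ?_
    calc _ ≤ _ := Polynomial.natDegree_mul_C_le _ _
      _ ≤ _ := Polynomial.natDegree_prod_le _ _
      _ ≤ ∑ _j : Fin p, 1 := Finset.sum_le_sum fun j _ => by compute_degree
      _ = p := by simp
  · simp only [contract_apply, Polynomial.eval_finsetSum, Polynomial.eval_mul,
      Polynomial.eval_prod, Polynomial.eval_add, Polynomial.eval_C, Polynomial.eval_X,
      PiLp.add_apply, PiLp.smul_apply, smul_eq_mul, Complex.ofReal_add, Complex.ofReal_mul,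
      mul_comm (u : ℂ)]

theorem sum_smul_iDelta {A : (Fin (p + 2) → Fin n) → ℂ}
    (hA : ∀ (π : Equiv.Perm (Fin (p + 2))) I, A (I ∘ π) = A I) (f : SymTensor n p) :
    ∑ I, A I • (iDelta f).1 I =
      ∑ I : Fin p → Fin n, (∑ a, A (Fin.append I ![a, a])) • f.1 I := by
  let c : (Fin (p + 2) → Fin n) → CompactDistribution n := fun J =>
    if J (Fin.natAdd p 0) = J (Fin.natAdd p 1) then f.1 fun j => J (Fin.castAdd 2 j) else 0
  have hsymm : ∀ π : Equiv.Perm (Fin (p + 2)), ∑ I, A I • c (I ∘ π) = ∑ I, A I • c I := by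
    intro π
    refine Fintype.sum_equiv (Equiv.arrowCongr π.symm (Equiv.refl _)) _ _ fun I => ?_
    change A I • c (I ∘ π) = A (I ∘ π) • c (I ∘ π)
    rw [hA]
  have hdiag : ∀ (I : Fin p → Fin n) a b, A (Fin.append I ![a, b]) • c (Fin.append I ![a, b]) =
      if a = b then A (Fin.append I ![a, a]) • f.1 I else 0 := by
    intro I a b
    simp only [c, Fin.append_left, Fin.append_right, Matrix.cons_val_zero, Matrix.cons_val_one]
    split_ifs with hab
    · rw [hab]
    · rw [smul_zero]
  calc ∑ I, A I • (iDelta f).1 I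
      = ((p + 2).factorial : ℂ)⁻¹ • ∑ π : Equiv.Perm (Fin (p + 2)), ∑ I, A I • c (I ∘ π) := by
        rw [Finset.sum_comm, Finset.smul_sum]
        refine Finset.sum_congr rfl fun I _ => ?_
        rw [← Finset.smul_sum, smul_comm]
        rfl
    _ = ∑ I, A I • c I := by
        rw [Finset.sum_congr rfl fun π _ => hsymm π, Finset.sum_const, Finset.card_univ,
          Fintype.card_perm, Fintype.card_fin, ← Nat.cast_smul_eq_nsmul ℂ, smul_smul,
          inv_mul_cancel₀ (Nat.cast_ne_zero.2 (Nat.factorial_ne_zero _)), one_smul]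
    _ = ∑ I : Fin p → Fin n, ∑ a, ∑ b,
          A (Fin.append I ![a, b]) • c (Fin.append I ![a, b]) := by
        rw [← (Fin.appendEquiv p 2).sum_comp, Fintype.sum_prod_type]
        refine Finset.sum_congr rfl fun I _ => ?_
        rw [← (finTwoArrowEquiv (Fin n)).symm.sum_comp, Fintype.sum_prod_type]
        rfl
    _ = _ := by simp only [hdiag, Finset.sum_ite_eq, Finset.mem_univ, if_true, Finset.sum_smul]

theorem contract_iDelta (ξ : Euc n) (f : SymTensor n p) :
    contract ξ (iDelta f) = (‖ξ‖ ^ 2 : ℂ) • contract ξ f := by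
  have htrace : ∀ I : Fin p → Fin n, ∑ a, ∏ j, (ξ (Fin.append I ![a, a] j) : ℂ) =
      (‖ξ‖ ^ 2 : ℂ) * ∏ j, (ξ (I j) : ℂ) := by
    intro I
    have hnorm : (‖ξ‖ ^ 2 : ℂ) = ∑ a, (ξ a : ℂ) ^ 2 := by
      exact_mod_cast EuclideanSpace.real_norm_sq_eq ξ
    simp only [hnorm, Finset.sum_mul, Fin.prod_univ_add, Fin.append_left, Fin.append_right,
      Fin.prod_univ_two, Matrix.cons_val_zero, Matrix.cons_val_one, ← pow_two, mul_comm]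
  calc contract ξ (iDelta f)
      = ∑ I : Fin p → Fin n, (∑ a, ∏ j, (ξ (Fin.append I ![a, a] j) : ℂ)) • f.1 I :=
        sum_smul_iDelta (fun π I => Equiv.prod_comp π fun j => (ξ (I j) : ℂ)) f
    _ = (‖ξ‖ ^ 2 : ℂ) • contract ξ f := by
        simp only [htrace, mul_smul, ← Finset.smul_sum]
        rfl

theorem contract_iDeltaPowTo {ξ : Euc n} (hξ : ‖ξ‖ = 1) (j : ℕ) (h : p + 2 * j = q)
    (f : SymTensor n p) : contract ξ (iDeltaPowTo j h f) = contract ξ f := by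
  subst h
  change contract ξ (iDeltaPow j f) = contract ξ f
  induction j with
  | zero => rfl
  | succ j ih =>
    change contract ξ (iDelta (iDeltaPow j f)) = contract ξ f
    rw [contract_iDelta, hξ, ih, Complex.ofReal_one, one_pow, one_smul]

/-- The total contraction `∑_{p=0}^m f^{(p)}_{i₁ … i_p} ξ^{i₁} ⋯ ξ^{i_p}` of `F = ∑_p f^{(p)}`. -/
def contractSum (ξ : Euc n) (F : TensorSum n m) : CompactDistribution n :=
  ∑ p, contract ξ (F p)

/-- The tensor field of the highest even rank at most `m` that agrees on unit vectors with the
sum of the components of `F` of even rank. -/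
def evenPart (F : TensorSum n m) : SymTensor n (2 * (m / 2)) :=
  F ⟨2 * (m / 2), by omega⟩ +
    ∑ l : Fin (m / 2), iDeltaPowTo (m / 2 - l) (by simp only; omega) (F ⟨2 * l, by omega⟩)

/-- The tensor field of the highest odd rank at most `m` that agrees on unit vectors with the
sum of the components of `F` of odd rank. -/
def oddPart (hm : 1 ≤ m) (F : TensorSum n m) : SymTensor n (2 * ((m - 1) / 2) + 1) :=
  F ⟨2 * ((m - 1) / 2) + 1, by omega⟩ +
    ∑ l : Fin ((m - 1) / 2),
      iDeltaPowTo ((m - 1) / 2 - l) (by simp only; omega) (F ⟨2 * l + 1, by omega⟩)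

theorem evenRelation_iff (F : TensorSum n m) : EvenRelation F ↔ evenPart F = 0 :=
  eq_neg_iff_add_eq_zero (G := SymTensor n (2 * (m / 2)))

theorem oddRelation_iff (hm : 1 ≤ m) (F : TensorSum n m) :
    OddRelation hm F ↔ oddPart hm F = 0 :=
  eq_neg_iff_add_eq_zero (G := SymTensor n (2 * ((m - 1) / 2) + 1))

theorem sum_range_even_add_odd {M : Type*} [AddCommMonoid M] (G : ℕ → M) (m : ℕ) :
    ∑ q ∈ Finset.range (m + 1), G q = ∑ l ∈ Finset.range (m / 2 + 1), G (2 * l) +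
      ∑ l ∈ Finset.range ((m + 1) / 2), G (2 * l + 1) := by
  induction m with
  | zero => simp
  | succ m ih =>
    rw [Finset.sum_range_succ, ih]
    rcases Nat.even_or_odd' m with ⟨r, rfl | rfl⟩
    · rw [show (2 * r + 1) / 2 = r by omega, show 2 * r / 2 = r by omega,
        show (2 * r + 1 + 1) / 2 = r + 1 by omega, Finset.sum_range_succ (fun l => G (2 * l + 1)),
        add_assoc]
    · rw [show (2 * r + 1) / 2 = r by omega, show (2 * r + 1 + 1) / 2 = r + 1 by omega,
        show (2 * r + 1 + 1 + 1) / 2 = r + 1 by omega,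
        Finset.sum_range_succ (fun l => G (2 * l)) (r + 1), add_right_comm]
      rfl

theorem contractSum_eq_evenPart_add_oddPart (hm : 1 ≤ m) (F : TensorSum n m) {ξ : Euc n}
    (hξ : ‖ξ‖ = 1) :
    contractSum ξ F = contract ξ (evenPart F) + contract ξ (oddPart hm F) := by
  let G : ℕ → CompactDistribution n := fun q =>
    if h : q < m + 1 then contract ξ (F ⟨q, h⟩) else 0
  have hG : ∀ q (h : q < m + 1), contract ξ (F ⟨q, h⟩) = G q := fun q h => by
    simp only [G, h, dif_pos]
  have hsum : contractSum ξ F = ∑ q ∈ Finset.range (m + 1), G q := by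
    rw [Finset.sum_range]
    exact Finset.sum_congr rfl fun q _ => hG q q.2
  rw [hsum, sum_range_even_add_odd, show (m + 1) / 2 = (m - 1) / 2 + 1 by omega,
    Finset.sum_range_succ, Finset.sum_range_succ, Finset.sum_range, Finset.sum_range]
  simp only [evenPart, oddPart, map_add, map_sum, contract_iDeltaPowTo hξ, hG]
  rw [add_comm (G (2 * (m / 2))), add_comm (G (2 * ((m - 1) / 2) + 1))]

end Contraction

section OneVariable

theorem polynomial_eq_zero_of_eval_eq_pow_mul {𝕜 : Type*} [RCLike 𝕜] {m : ℕ} {Q : Polynomial 𝕜}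
    (hQ : Q.natDegree ≤ m) {g : ℝ → 𝕜} (hg : ContinuousAt g 0)
    (h : ∀ u : ℝ, Q.eval (u : 𝕜) = (u : 𝕜) ^ (m + 1) * g u) : Q = 0 := by
  by_contra hne
  obtain ⟨P, hP, hP0⟩ := Polynomial.exists_eq_pow_rootMultiplicity_mul_and_not_dvd Q hne 0
  set r := Q.rootMultiplicity 0
  rw [Polynomial.C_0, sub_zero] at hP hP0
  rw [Polynomial.X_dvd_iff, Polynomial.coeff_zero_eq_eval_zero] at hP0
  have hr : r ≤ m := by
    simpa using (Polynomial.natDegree_le_of_dvd (Dvd.intro P hP.symm) hne).trans hQ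
  have hPg : ∀ u : ℝ, u ≠ 0 → P.eval (u : 𝕜) = (u : 𝕜) ^ (m + 1 - r) * g u := by
    intro u hu
    refine mul_left_cancel₀ (pow_ne_zero r (RCLike.ofReal_ne_zero.2 hu)) ?_
    rw [← mul_assoc, ← pow_add, Nat.add_sub_cancel' (by omega), ← h u]
    conv_rhs => rw [hP]
    simp
  have hleft : Filter.Tendsto (fun u : ℝ => P.eval (u : 𝕜)) (nhdsWithin 0 {0}ᶜ)
      (nhds (P.eval 0)) := by
    have hcont : Continuous fun u : ℝ => P.eval (u : 𝕜) :=
      P.continuous.comp RCLike.continuous_ofReal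
    simpa using (hcont.tendsto 0).mono_left nhdsWithin_le_nhds
  have hright : Filter.Tendsto (fun u : ℝ => (u : 𝕜) ^ (m + 1 - r) * g u) (nhdsWithin 0 {0}ᶜ)
      (nhds 0) := by
    have hcont : ContinuousAt (fun u : ℝ => (u : 𝕜) ^ (m + 1 - r) * g u) 0 :=
      (RCLike.continuous_ofReal.pow _).continuousAt.mul hg
    simpa [show m + 1 - r ≠ 0 by omega] using
      hcont.tendsto.mono_left (nhdsWithin_le_nhds (s := {0}ᶜ))
  refine hP0 (tendsto_nhds_unique hleft (hright.congr' ?_))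
  filter_upwards [self_mem_nhdsWithin] with u hu using (hPg u hu).symm

theorem eq_sum_pow_smul_add_pow_smul_iterate_dslope {𝕜 E : Type*} [NontriviallyNormedField 𝕜]
    [NormedAddCommGroup E] [NormedSpace 𝕜 E] (f : 𝕜 → E) (a z : 𝕜) (N : ℕ) :
    f z = ∑ k ∈ Finset.range N, (z - a) ^ k • (Function.swap dslope a)^[k] f a +
      (z - a) ^ N • (Function.swap dslope a)^[N] f z := by
  induction N with
  | zero => simp
  | succ N ih =>
    have hstep : (Function.swap dslope a)^[N] f z = (Function.swap dslope a)^[N] f a +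
        (z - a) • (Function.swap dslope a)^[N + 1] f z := by
      rw [Function.iterate_succ_apply', Function.swap, sub_smul_dslope, add_sub_cancel]
    rw [ih, hstep, Finset.sum_range_succ, smul_add, smul_smul, ← pow_succ, add_assoc]

theorem differentiable_iterate_dslope {E : Type*} [NormedAddCommGroup E] [NormedSpace ℂ E]
    [CompleteSpace E] {f : ℂ → E} (hf : Differentiable ℂ f) (a : ℂ) (k : ℕ) :
    Differentiable ℂ ((Function.swap dslope a)^[k] f) := by
  induction k with
  | zero => exact hf
  | succ k ih =>
    rw [Function.iterate_succ_apply', ← differentiableOn_univ] at *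
    exact (Complex.differentiableOn_dslope Filter.univ_mem).2 ih

section Moments

variable {E ι : Type*} [NormedAddCommGroup E] [NormedSpace ℝ E] [MeasurableSpace E]
  [BorelSpace E] {μ : Measure E} [IsLocallyFiniteMeasure μ] {g : ι → E → ℝ}

theorem integrable_mul_of_contDiff_of_hasCompactSupport (hg : ∀ i, Continuous (g i)) {ρ : E → ℝ}
    (hρ : ContDiff ℝ ∞ ρ) (hρc : HasCompactSupport ρ) (i : ι) :
    Integrable (fun x => ρ x * g i x) μ :=
  (hρ.continuous.mul (hg i)).integrable_of_hasCompactSupport hρc.mul_right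

variable [FiniteDimensional ℝ E] [μ.IsOpenPosMeasure]

theorem sum_smul_eq_zero_of_forall_sum_integral_eq_zero [Fintype ι]
    (hg : ∀ i, Continuous (g i)) {b : ι → ℝ}
    (h : ∀ ρ : E → ℝ, ContDiff ℝ ∞ ρ → HasCompactSupport ρ →
      ∑ i, (∫ x, ρ x * g i x ∂μ) * b i = 0) : ∑ i, b i • g i = 0 := by
  have hcont : Continuous (∑ i, b i • g i) := by
    rw [Finset.sum_fn]
    exact continuous_finsetSum _ fun i _ => (hg i).const_smul (b i)
  refine (hcont.ae_eq_iff_eq μ continuous_zero).1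
    (ae_eq_zero_of_integral_contDiff_smul_eq_zero hcont.locallyIntegrable fun ρ hρ hρc => ?_)
  rw [← h ρ hρ hρc]
  simp only [← integral_mul_const]
  rw [← integral_finsetSum _ fun i _ =>
    (integrable_mul_of_contDiff_of_hasCompactSupport hg hρ hρc i).mul_const (b i)]
  refine integral_congr_ae (.of_forall fun x => ?_)
  simp only [Finset.sum_apply, Pi.smul_apply, smul_eq_mul, Finset.mul_sum, mul_assoc,
    mul_comm (b _)]

theorem exists_contDiff_hasCompactSupport_integral_mul_eq [Finite ι]
    (hg : ∀ i, Continuous (g i)) (hind : LinearIndependent ℝ g) (c : ι → ℝ) :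
    ∃ ρ : E → ℝ, ContDiff ℝ ∞ ρ ∧ HasCompactSupport ρ ∧ ∀ i, ∫ x, ρ x * g i x ∂μ = c i := by
  classical
  have := Fintype.ofFinite ι
  let V : Submodule ℝ (ι → ℝ) :=
    { carrier := {c | ∃ ρ : E → ℝ, ContDiff ℝ ∞ ρ ∧ HasCompactSupport ρ ∧
        ∀ i, ∫ x, ρ x * g i x ∂μ = c i}
      zero_mem' := ⟨0, contDiff_const, HasCompactSupport.zero, by simp⟩
      add_mem' := by
        rintro c d ⟨ρ, hρ, hρc, hρi⟩ ⟨τ, hτ, hτc, hτi⟩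
        refine ⟨ρ + τ, hρ.add hτ, hρc.add hτc, fun i => ?_⟩
        simp only [Pi.add_apply, add_mul]
        rw [integral_add (integrable_mul_of_contDiff_of_hasCompactSupport hg hρ hρc i)
          (integrable_mul_of_contDiff_of_hasCompactSupport hg hτ hτc i), hρi, hτi]
      smul_mem' := by
        rintro r c ⟨ρ, hρ, hρc, hρi⟩
        refine ⟨r • ρ, hρ.const_smul r, hρc.smul_left (f := fun _ => r), fun i => ?_⟩
        simp only [Pi.smul_apply, smul_eq_mul, mul_assoc, integral_const_mul, hρi] }
  suffices hV : V = ⊤ from (hV ▸ Submodule.mem_top : c ∈ V)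
  by_contra hne
  obtain ⟨l, hl, hVl⟩ := Submodule.exists_le_ker_of_lt_top V (lt_top_iff_ne_top.2 hne)
  have hlv : ∀ v, l v = ∑ i, v i * l (Pi.single i 1) := fun v => by
    conv_lhs => rw [pi_eq_sum_univ' v]
    simp
  have hzero : ∑ i, l (Pi.single i 1) • g i = 0 :=
    sum_smul_eq_zero_of_forall_sum_integral_eq_zero (μ := μ) hg fun ρ hρ hρc =>
      (hlv _).symm.trans (hVl ⟨ρ, hρ, hρc, fun _ => rfl⟩)
  refine hl (LinearMap.ext fun v => ?_)
  rw [hlv v]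
  simp only [Fintype.linearIndependent_iff.1 hind _ hzero, mul_zero, Finset.sum_const_zero,
    LinearMap.zero_apply]

end Moments

theorem linearIndependent_pow_apply (R : Type*) [CommRing R] [IsDomain R] [Infinite R] (N : ℕ) :
    LinearIndependent R fun (j : Fin N) (t : R) => t ^ (j : ℕ) := by
  refine Fintype.linearIndependent_iff.2 fun b hb j => ?_
  have hP : ∑ i : Fin N, Polynomial.monomial (i : ℕ) (b i) = 0 := Polynomial.funext fun t => by
    simpa [Polynomial.eval_finsetSum] using congrFun hb t
  simpa [Polynomial.finsetSum_coeff, Polynomial.coeff_monomial, Fin.val_inj] using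
    congrArg (fun P => Polynomial.coeff P j) hP

theorem exists_contDiff_integral_pow_mul_comp_sub_eq_pow {k m : ℕ} (hk : k ≤ m) :
    ∃ ρ : ℝ → ℝ, ContDiff ℝ ∞ ρ ∧ HasCompactSupport ρ ∧
      ∀ s : ℝ, ∫ t : ℝ, t ^ m * ρ (s - t) = s ^ k := by
  obtain ⟨ρ, hρ, hρc, hmoment⟩ := exists_contDiff_hasCompactSupport_integral_mul_eq
    (μ := volume) (fun j : Fin (m + 1) => continuous_pow (j : ℕ)) (linearIndependent_pow_apply ℝ _)
    fun j => if (j : ℕ) = m - k then (-1) ^ (m - k) / (m.choose k : ℝ) else 0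
  refine ⟨ρ, hρ, hρc, fun s => ?_⟩
  have hint : ∀ j : ℕ, Integrable fun τ : ℝ => ρ τ * τ ^ j := fun j =>
    (hρ.continuous.mul (continuous_pow j)).integrable_of_hasCompactSupport hρc.mul_right
  have hbinom : ∀ τ : ℝ, (s - τ) ^ m * ρ τ = ∑ j ∈ Finset.range (m + 1),
      s ^ j * (-1) ^ (m - j) * (m.choose j : ℝ) * (ρ τ * τ ^ (m - j)) := by
    intro τ
    rw [sub_eq_add_neg, add_pow, Finset.sum_mul]
    exact Finset.sum_congr rfl fun j _ => by rw [neg_pow τ]; ring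
  calc ∫ t : ℝ, t ^ m * ρ (s - t) = ∫ τ, (s - τ) ^ m * ρ τ := by
        rw [← integral_sub_left_eq_self _ volume s]
        simp only [sub_sub_cancel]
    _ = ∑ j ∈ Finset.range (m + 1),
          s ^ j * (-1) ^ (m - j) * (m.choose j : ℝ) * ∫ τ, ρ τ * τ ^ (m - j) := by
        simp only [hbinom]
        rw [integral_finsetSum _ fun j _ => (hint _).const_mul _]
        simp only [integral_const_mul]
    _ = s ^ k * (-1) ^ (m - k) * (m.choose k : ℝ) * ∫ τ, ρ τ * τ ^ (m - k) := by
        refine Finset.sum_eq_single_of_mem k (by simp; omega) fun j hj hjk => ?_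
        have hne : m - j ≠ m - k := by have := Finset.mem_range.1 hj; omega
        rw [hmoment ⟨m - j, by omega⟩, if_neg hne, mul_zero]
    _ = s ^ k := by
        have hchoose : (m.choose k : ℝ) ≠ 0 := Nat.cast_ne_zero.2 (Nat.choose_pos hk).ne'
        have hsign : (-1 : ℝ) ^ (m - k) * (-1) ^ (m - k) = 1 := by
          rw [← mul_pow, neg_one_mul, neg_neg, one_pow]
        rw [hmoment ⟨m - k, by omega⟩, if_pos rfl]
        field_simp
        linear_combination s ^ k * hsign

end OneVariable

section RayWaves

variable {n m p : ℕ}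

/-- The function `x ↦ (x ⬝ ξ) ^ k exp (i x ⬝ y)`. Pairing with it for all `y ⊥ ξ` gives the
Fourier transform of the `k`-th moment along the lines of direction `ξ`. -/
def rayWave (k : ℕ) (ξ y : Euc n) : Smooth n :=
  ⟨fun x => ((inner ℝ x ξ : ℝ) : ℂ) ^ k * (planeWave y).1 x,
    ((contDiff_ofReal_inner.comp (contDiff_id.prodMk contDiff_const)).pow k).mul (planeWave y).2⟩

theorem rayWave_smul (k : ℕ) (r : ℝ) (ξ y : Euc n) :
    rayWave k (r • ξ) y = (r : ℂ) ^ k • rayWave k ξ y := by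
  refine Subtype.ext (funext fun x => ?_)
  simp only [rayWave, inner_smul_right, Submodule.coe_smul, Pi.smul_apply, smul_eq_mul,
    Complex.ofReal_mul, mul_pow, mul_assoc]

theorem planeWave_add_smul_apply (ζ ξ : Euc n) (s : ℝ) (x : Euc n) :
    (planeWave (ζ + s • ξ)).1 x =
      Complex.exp (Complex.I * s * (inner ℝ x ξ : ℝ)) * (planeWave ζ).1 x := by
  simp only [planeWave, inner_add_right, inner_smul_right, ← Complex.exp_add]
  push_cast
  ring_nf

theorem exists_planeWave_add_smul_eq (N : ℕ) :
    ∃ (a : ℕ → ℂ) (Φ : (ℝ × Euc n × Euc n) × Euc n → ℂ) (hΦ : ContDiff ℝ ∞ Φ),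
      ∀ (s : ℝ) (ξ ζ : Euc n),
      planeWave (ζ + s • ξ) = ∑ k ∈ Finset.range N, (a k * (s : ℂ) ^ k) • rayWave k ξ ζ +
        (s : ℂ) ^ N • slice hΦ (s, ξ, ζ) := by
  let g : ℂ → ℂ := (Function.swap dslope 0)^[N] Complex.exp
  have hg : ContDiff ℝ ∞ g :=
    (differentiable_iterate_dslope Complex.differentiable_exp 0 N).contDiff.restrict_scalars ℝ
  let w : (ℝ × Euc n × Euc n) × Euc n → ℂ := fun q =>
    Complex.I * ((inner ℝ q.2 q.1.2.1 : ℝ) : ℂ)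
  have hw : ContDiff ℝ ∞ w := contDiff_const.mul
    (Complex.ofRealCLM.contDiff.comp (contDiff_snd.inner ℝ contDiff_fst.snd.fst))
  have hs : ContDiff ℝ ∞ fun q : (ℝ × Euc n × Euc n) × Euc n => (q.1.1 : ℂ) :=
    Complex.ofRealCLM.contDiff.comp contDiff_fst.fst
  have hζ : ContDiff ℝ ∞ fun q : (ℝ × Euc n × Euc n) × Euc n => (planeWave q.1.2.2).1 q.2 :=
    ContDiff.comp (g := fun q : Euc n × Euc n => (planeWave q.1).1 q.2)
      (f := fun q : (ℝ × Euc n × Euc n) × Euc n => (q.1.2.2, q.2)) contDiff_planeWave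
      (contDiff_fst.snd.snd.prodMk contDiff_snd)
  refine ⟨fun k => Complex.I ^ k * (Function.swap dslope 0)^[k] Complex.exp 0,
    fun q => w q ^ N * g (q.1.1 * w q) * (planeWave q.1.2.2).1 q.2,
    ((hw.pow N).mul (hg.comp (hs.mul hw))).mul hζ, fun s ξ ζ => ?_⟩
  refine Subtype.ext (funext fun x => ?_)
  have hexp := eq_sum_pow_smul_add_pow_smul_iterate_dslope Complex.exp 0
    (s * (Complex.I * (inner ℝ x ξ : ℝ))) N
  simp only [sub_zero, smul_eq_mul] at hexp
  rw [planeWave_add_smul_apply, mul_comm Complex.I, mul_assoc, hexp]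
  simp only [rayWave, slice, Submodule.coe_add, Submodule.coe_sum, Submodule.coe_smul,
    Pi.add_apply, Finset.sum_apply, Pi.smul_apply, smul_eq_mul, add_mul, Finset.sum_mul, w, g]
  congr 1
  · exact Finset.sum_congr rfl fun k _ => by ring
  · ring

theorem inner_add_smul_sub_smul_eq_zero {E : Type*} [NormedAddCommGroup E]
    [InnerProductSpace ℝ E] {η y : E} (hη : η ≠ 0) (hηy : inner ℝ η y = 0) (u : ℝ) :
    inner ℝ (η + u • y)
      (y - (u * (‖y‖ ^ 2 / (‖η‖ ^ 2 + u ^ 2 * ‖y‖ ^ 2))) • (η + u • y)) = 0 := by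
  have hyη : inner ℝ y η = 0 := real_inner_comm y η ▸ hηy
  have hpos : ‖η‖ ^ 2 + u ^ 2 * ‖y‖ ^ 2 ≠ 0 := by
    have := norm_pos_iff.2 hη
    positivity
  simp only [inner_sub_right, inner_add_left, inner_add_right, inner_smul_left, inner_smul_right,
    hηy, hyη, real_inner_self_eq_norm_sq, conj_trivial]
  field_simp
  ring

/-- Vanishing of the moments up to order `m` makes the polynomial `u ↦ ⟨f, (η + u y)^p e^{iy·x}⟩`,
of degree at most `m`, vanish to order `m + 1` at `u = 0`: the component of `y` along `η + u y`
is `O(u)`. -/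
theorem contract_add_smul_planeWave_eq_zero (hp : p ≤ m) {f : SymTensor n p}
    (h : ∀ ξ y : Euc n, ξ ≠ 0 → inner ℝ ξ y = 0 → ∀ k ≤ m,
      (contract ξ f).1 (rayWave k ξ y) = 0)
    {η y : Euc n} (hη : η ≠ 0) (hηy : inner ℝ η y = 0) (u : ℝ) :
    (contract (η + u • y) f).1 (planeWave y) = 0 := by
  obtain ⟨Q, hQdeg, hQ⟩ := exists_polynomial_eval_eq_contract f (planeWave y) η y
  obtain ⟨a, Φ, hΦ, hexp⟩ := exists_planeWave_add_smul_eq (n := n) (m + 1)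
  let c : ℝ → ℝ := fun u => ‖y‖ ^ 2 / (‖η‖ ^ 2 + u ^ 2 * ‖y‖ ^ 2)
  have hc : Continuous c := by
    have := norm_pos_iff.2 hη
    exact continuous_const.div (by fun_prop) fun u => by positivity
  let q : ℝ → ℝ × Euc n × Euc n := fun u =>
    (u * c u, η + u • y, y - (u * c u) • (η + u • y))
  have hq : Continuous q := by fun_prop
  have hne : ∀ u : ℝ, η + u • y ≠ 0 := fun u h0 => hη <| by
    simpa [inner_add_right, inner_smul_right, hηy] using congrArg (inner ℝ η) h0
  have hremainder : ∀ u : ℝ, (contract (η + u • y) f).1 (planeWave y) =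
      (u : ℂ) ^ (m + 1) * ((c u : ℂ) ^ (m + 1) *
        (contract (η + u • y) f).1 (slice hΦ (q u))) := by
    intro u
    have hwave := hexp (q u).1 (q u).2.1 (q u).2.2
    rw [show (q u).2.2 + (q u).1 • (q u).2.1 = y from sub_add_cancel _ _] at hwave
    rw [hwave, map_add, map_sum, map_smul, Finset.sum_eq_zero, zero_add, smul_eq_mul,
      Complex.ofReal_mul, mul_pow, mul_assoc]
    intro k hk
    rw [map_smul, h _ _ (hne u) (inner_add_smul_sub_smul_eq_zero hη hηy u) k
      (Finset.mem_range_succ_iff.1 hk), smul_zero]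
  have hcont : Continuous fun u : ℝ => (c u : ℂ) ^ (m + 1) *
      (contract (η + u • y) f).1 (slice hΦ (q u)) := by
    refine Continuous.mul (by fun_prop) (continuous_contract_pairing f (by fun_prop) fun j => ?_)
    exact (continuous_iteratedFDeriv_right hΦ j).comp (hq.prodMap continuous_id)
  rw [← hQ, polynomial_eq_zero_of_eval_eq_pow_mul (hQdeg.trans hp) hcont.continuousAt
    fun u => (hQ u).trans (hremainder u), Polynomial.eval_zero]

theorem eq_zero_of_forall_contract_rayWave (hn : 2 ≤ n) (hp : p ≤ m) {f : SymTensor n p}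
    (h : ∀ ξ y : Euc n, ‖ξ‖ = 1 → inner ℝ ξ y = 0 → ∀ k ≤ m,
      (contract ξ f).1 (rayWave k ξ y) = 0) : f = 0 := by
  have hdir : ∀ ξ y : Euc n, ξ ≠ 0 → inner ℝ ξ y = 0 → ∀ k ≤ m,
      (contract ξ f).1 (rayWave k ξ y) = 0 := by
    intro ξ y hξ hξy k hk
    have hunit := h (‖ξ‖⁻¹ • ξ) y (norm_smul_inv_norm (𝕜 := ℝ) hξ)
      (by rw [inner_smul_left, hξy, mul_zero]) k hk
    simpa [contract_smul, rayWave_smul, hξ] using hunit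
  refine eq_zero_of_forall_contract_eq_zero fun ξ => eq_zero_of_forall_planeWave _ fun y => ?_
  have hcont : Continuous fun ξ => (contract ξ f).1 (planeWave y) :=
    continuous_contract_pairing f continuous_id fun j =>
      (ContDiff.continuous_iteratedFDeriv (n := ∞) (by exact_mod_cast le_top)
        (planeWave y).2).comp continuous_snd
  have hdense : Dense (Set.range fun u : ℝ => u • y)ᶜ :=
    ContDiff.dense_compl_range_of_finrank_lt_finrank (contDiff_id.smul contDiff_const)
      (by simpa using Nat.lt_of_succ_le hn)
  refine congrFun (hcont.ext_on hdense continuous_const fun ξ hξ => ?_) ξ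
  let u : ℝ := inner ℝ ξ y / inner ℝ y y
  have hperp : inner ℝ (ξ - u • y) y = 0 := by
    rw [inner_sub_left, inner_smul_left, conj_trivial, sub_eq_zero]
    rcases eq_or_ne y 0 with rfl | hy
    · simp
    · exact (div_mul_cancel₀ _ (inner_self_ne_zero.2 hy)).symm
  have hη : ξ - u • y ≠ 0 := fun h0 => hξ ⟨u, (sub_eq_zero.1 h0).symm⟩
  simpa using contract_add_smul_planeWave_eq_zero hp hdir hη hperp u

end RayWaves

section RayMoments

variable {n m p : ℕ}

/-- The `k`-th moments `x ↦ ∫ t^k Ψ(x - t ξ, ξ) dt` of `Ψ` along the lines of direction `ξ`, as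
the adjoint transform of rank zero for the unit mass at `ξ`. -/
def rayMoment (k : ℕ) (Ψ : TestFunction n) (ξ : Euc n) : Smooth n :=
  momentAdjoint (Measure.dirac ξ) k Ψ (Fin.elim0 : Fin 0 → Fin n)

theorem rayMoment_apply (k : ℕ) (Ψ : TestFunction n) (ξ x : Euc n) :
    (rayMoment k Ψ ξ).1 x = ∫ t : ℝ, (t : ℂ) ^ k * Ψ.toFun (x - t • ξ, ξ) := by
  simp [rayMoment, momentAdjoint, adjointIntegrand]

theorem contDiff_adjointIntegrand_swap (k : ℕ) (Ψ : TestFunction n) (I : Fin p → Fin n) :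
    ContDiff ℝ ∞ fun q : (Euc n × ℝ) × Euc n => adjointIntegrand k Ψ I q.2 q.1.1 q.1.2 :=
  ContDiff.comp (g := fun q : Euc n × (Euc n × ℝ) => adjointIntegrand k Ψ I q.1 q.2.1 q.2.2)
    (f := fun q : (Euc n × ℝ) × Euc n => (q.2, q.1)) (adjointIntegrand_contDiff k Ψ I)
    (contDiff_snd.prodMk contDiff_fst)

section Fubini

variable (ν : Measure (Euc n)) [IsFiniteMeasureOnCompacts ν] (T : CompactDistribution n)
  (k : ℕ) (Ψ : TestFunction n) (I : Fin p → Fin n)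

theorem integrable_pairing_adjointIntegrand :
    Integrable (fun q => T.1 (slice (contDiff_adjointIntegrand_swap k Ψ I) q))
      (ν.prod volume) := by
  obtain ⟨R, hR⟩ := exists_pairing_eq_of_eqOn_ball T
  obtain ⟨A, hA, hA0⟩ := adjointIntegrand_support k Ψ I R
  refine (continuous_pairing_slice T _).integrable_of_hasCompactSupport
    (HasCompactSupport.intro hA fun q hq => ?_)
  exact (hR _ 0 fun x hx => hA0 x hx q hq).trans (map_zero _)

theorem integrable_adjointIntegrand (x : Euc n) :
    Integrable (fun q : Euc n × ℝ => adjointIntegrand k Ψ I x q.1 q.2) (ν.prod volume) := by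
  obtain ⟨A, hA, hA0⟩ := adjointIntegrand_support k Ψ I (‖x‖ + 1)
  exact ((contDiff_adjointIntegrand_swap k Ψ I).continuous.comp
    (.prodMk continuous_id continuous_const)).integrable_of_hasCompactSupport
    (HasCompactSupport.intro hA fun q hq => hA0 x (lt_add_one _) q hq)

theorem pairing_momentAdjoint_eq_integral_integral [SFinite ν] :
    T.1 (momentAdjoint ν k Ψ I) =
      ∫ ξ, ∫ t, T.1 (slice (contDiff_adjointIntegrand_swap k Ψ I) (ξ, t)) ∂volume ∂ν := by
  rw [← integral_prod _ (integrable_pairing_adjointIntegrand ν T k Ψ I)]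
  exact pairing_integral T (isDominatedSmoothFamily_of_compact (ν.prod volume)
    (contDiff_adjointIntegrand_swap k Ψ I) (adjointIntegrand_support k Ψ I))
    fun x => (integral_prod _ (integrable_adjointIntegrand ν k Ψ I x)).symm

theorem integral_pairing_adjointIntegrand (ξ : Euc n) :
    ∫ t, T.1 (slice (contDiff_adjointIntegrand_swap k Ψ I) (ξ, t)) =
      (∏ j, (ξ (I j) : ℂ)) * T.1 (rayMoment k Ψ ξ) := by
  have hslice : ∀ t : ℝ, slice (contDiff_adjointIntegrand_swap k Ψ I) (ξ, t) =
      (∏ j, (ξ (I j) : ℂ)) •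
        slice (contDiff_adjointIntegrand_swap k Ψ (Fin.elim0 : Fin 0 → Fin n)) (ξ, t) := by
    refine fun t => Subtype.ext (funext fun x => ?_)
    simp only [slice, adjointIntegrand, Submodule.coe_smul, Pi.smul_apply, smul_eq_mul,
      Finset.univ_eq_empty, Finset.prod_empty]
    ring
  simp only [hslice, map_smul, smul_eq_mul, integral_const_mul]
  rw [rayMoment, pairing_momentAdjoint_eq_integral_integral, integral_dirac]

theorem integrable_prod_mul_pairing_rayMoment :
    Integrable (fun ξ => (∏ j, (ξ (I j) : ℂ)) * T.1 (rayMoment k Ψ ξ)) ν := by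
  simpa only [integral_pairing_adjointIntegrand] using
    (integrable_pairing_adjointIntegrand ν T k Ψ I).integral_prod_left

theorem momentRayTransform_eq_integral [SFinite ν] (F : TensorSum n m) :
    momentRayTransform ν k F Ψ = ∫ ξ, (contractSum ξ F).1 (rayMoment k Ψ ξ) ∂ν := by
  simp only [momentRayTransform, pairing_momentAdjoint_eq_integral_integral,
    integral_pairing_adjointIntegrand, contractSum, Submodule.coe_sum, LinearMap.sum_apply,
    contract_apply]
  rw [integral_finsetSum _ fun p _ => integrable_finsetSum _ fun I _ =>
    integrable_prod_mul_pairing_rayMoment ν _ k Ψ _]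
  exact Finset.sum_congr rfl fun p _ => (integral_finsetSum _ fun I _ =>
    integrable_prod_mul_pairing_rayMoment ν _ k Ψ _).symm

end Fubini

theorem ae_norm_eq_one (n : ℕ) : ∀ᵐ ξ ∂sphereMeasure n, ‖ξ‖ = 1 := by
  rw [sphereMeasure, ae_map_iff measurable_subtype_coe.aemeasurable
    (measurableSet_eq_fun measurable_norm measurable_const)]
  exact .of_forall fun ξ => norm_eq_of_mem_sphere ξ

theorem sphereTransform_eq_zero_of_contractSum {F : TensorSum n m}
    (h : ∀ ξ : Euc n, ‖ξ‖ = 1 → contractSum ξ F = 0) (k : ℕ) : sphereTransform k F = 0 := by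
  funext Ψ
  rw [sphereTransform, momentRayTransform_eq_integral]
  refine integral_eq_zero_of_ae ?_
  filter_upwards [ae_norm_eq_one n] with ξ hξ
  simp [h ξ hξ]

theorem eq_zero_on_sphere_of_integral_smul_eq_zero {F : Type*} [NormedAddCommGroup F]
    [NormedSpace ℝ F] [CompleteSpace F] {B : Euc n → F} (hB : Continuous B)
    (h : ∀ α : Euc n → ℝ, ContDiff ℝ ∞ α → HasCompactSupport α → tsupport α ⊆ {0}ᶜ →
      ∫ ξ, α ξ • B ξ ∂sphereMeasure n = 0) {ξ : Euc n} (hξ : ‖ξ‖ = 1) : B ξ = 0 := by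
  have hpunctured := isOpen_compl_singleton.ae_eq_zero_of_integral_contDiff_smul_eq_zero
    ((hB.locallyIntegrable (μ := sphereMeasure n)).locallyIntegrableOn _) h
  have hae : ∀ᵐ ξ ∂sphereMeasure n, B ξ = 0 := by
    filter_upwards [hpunctured, ae_norm_eq_one n] with ξ hBξ hξ
    exact hBξ (norm_ne_zero_iff.1 (hξ ▸ one_ne_zero))
  have hsphere : (fun θ : Metric.sphere (0 : Euc n) 1 => B θ) = fun _ => 0 :=
    ((hB.comp continuous_subtype_val).ae_eq_iff_eq (volume : Measure (Euc n)).toSphere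
      continuous_const).1 (ae_of_ae_map measurable_subtype_coe.aemeasurable hae)
  exact congrFun hsphere ⟨ξ, mem_sphere_zero_iff_norm.2 hξ⟩

end RayMoments

section RayTests

variable {n m : ℕ}

/-- The component of `x` orthogonal to `ξ` when `ξ` is a unit vector; the formula is used for
every `ξ`, in order to be smooth in `ξ`. -/
def perp (ξ x : Euc n) : Euc n := x - (inner ℝ x ξ : ℝ) • ξ

theorem contDiff_perp : ContDiff ℝ ∞ fun q : Euc n × Euc n => perp q.1 q.2 :=
  contDiff_snd.sub ((contDiff_snd.inner ℝ contDiff_fst).smul contDiff_fst)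

theorem perp_sub_smul {ξ : Euc n} (hξ : ‖ξ‖ = 1) (x : Euc n) (t : ℝ) :
    perp ξ (x - t • ξ) = perp ξ x := by
  simp only [perp, inner_sub_left, inner_smul_left, real_inner_self_eq_norm_sq, hξ, conj_trivial,
    one_pow, mul_one, sub_smul]
  abel

theorem norm_perp_le {ξ : Euc n} (hξ : ‖ξ‖ = 1) (x : Euc n) : ‖perp ξ x‖ ≤ ‖x‖ := by
  refine le_of_sq_le_sq ?_ (norm_nonneg x)
  rw [perp, norm_sub_sq_real, norm_smul, inner_smul_right, hξ, mul_one, Real.norm_eq_abs, sq_abs]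
  nlinarith [sq_nonneg (inner ℝ x ξ : ℝ)]

theorem norm_le_norm_perp_add (ξ x : Euc n) : ‖x‖ ≤ ‖perp ξ x‖ + |inner ℝ x ξ| * ‖ξ‖ := by
  simpa [perp, norm_smul] using norm_add_le (perp ξ x) ((inner ℝ x ξ : ℝ) • ξ)

theorem planeWave_perp {ξ y : Euc n} (hξy : inner ℝ ξ y = 0) (x : Euc n) :
    (planeWave y).1 (perp ξ x) = (planeWave y).1 x := by
  simp only [planeWave, perp, inner_sub_left, inner_smul_left, hξy, mul_zero, sub_zero]

section

variable {α : Euc n → ℝ} {ρ : ℝ → ℝ} {φ : Smooth n}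

theorem contDiff_inner_pow_mul_perp (k : ℕ) (φ : Smooth n) :
    ContDiff ℝ ∞ fun q : Euc n × Euc n =>
      ((inner ℝ q.2 q.1 : ℝ) : ℂ) ^ k * φ.1 (perp q.1 q.2) :=
  ((contDiff_ofReal_inner.comp (contDiff_snd.prodMk contDiff_fst)).pow k).mul
    (ContDiff.comp (n := ∞) φ.2 contDiff_perp)

theorem hasCompactSupport_mul_inner_mul_perp (hα : HasCompactSupport α)
    (hρ : HasCompactSupport ρ) (hφ : HasCompactSupport φ.1) :
    HasCompactSupport fun q : Euc n × Euc n =>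
      (α q.2 : ℂ) * (ρ (inner ℝ q.1 q.2) : ℂ) * φ.1 (perp q.2 q.1) := by
  obtain ⟨A, hA⟩ := hα.isBounded.exists_norm_le
  obtain ⟨B, hB⟩ := hρ.isBounded.exists_norm_le
  obtain ⟨C, hC⟩ := hφ.isBounded.exists_norm_le
  refine HasCompactSupport.intro ((isCompact_closedBall (0 : Euc n) (C + B * A)).prod
    (isCompact_closedBall (0 : Euc n) A)) fun q => ?_
  contrapose!
  intro hne
  simp only [ne_eq, mul_eq_zero, Complex.ofReal_eq_zero, not_or] at hne
  have hαq := hA _ (subset_tsupport _ hne.1.1)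
  have hρq := hB _ (subset_tsupport _ hne.1.2)
  have hφq := hC _ (subset_tsupport _ hne.2)
  refine ⟨mem_closedBall_zero_iff.2 ?_, mem_closedBall_zero_iff.2 hαq⟩
  refine (norm_le_norm_perp_add q.2 q.1).trans (add_le_add hφq ?_)
  exact mul_le_mul hρq hαq (norm_nonneg _) ((norm_nonneg _).trans hρq)

/-- The test function `α(ξ) ρ(x ⬝ ξ) φ(z)`, with `z` the component of `x` orthogonal to `ξ`. -/
def rayTest (hα : ContDiff ℝ ∞ α) (hαc : HasCompactSupport α) (hα0 : tsupport α ⊆ {0}ᶜ)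
    (hρ : ContDiff ℝ ∞ ρ) (hρc : HasCompactSupport ρ) (hφc : HasCompactSupport φ.1) :
    TestFunction n where
  toFun q := (α q.2 : ℂ) * (ρ (inner ℝ q.1 q.2) : ℂ) * φ.1 (perp q.2 q.1)
  smooth := ((Complex.ofRealCLM.contDiff.comp (hα.comp contDiff_snd)).mul
    (Complex.ofRealCLM.contDiff.comp (hρ.comp (contDiff_fst.inner ℝ contDiff_snd)))).mul
    (ContDiff.comp (n := ∞) φ.2 (contDiff_perp.comp (contDiff_snd.prodMk contDiff_fst)))
  compact := hasCompactSupport_mul_inner_mul_perp hαc hρc hφc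
  support_ne q hq := by
    refine hα0 (closure_minimal (fun q hq => ?_)
      ((isClosed_tsupport α).preimage continuous_snd) hq)
    exact subset_tsupport _ fun h => hq (by simp [h])

theorem rayMoment_rayTest {k : ℕ} (hα : ContDiff ℝ ∞ α) (hαc : HasCompactSupport α)
    (hα0 : tsupport α ⊆ {0}ᶜ) (hρ : ContDiff ℝ ∞ ρ) (hρc : HasCompactSupport ρ)
    (hφc : HasCompactSupport φ.1) (hρm : ∀ s : ℝ, ∫ t : ℝ, t ^ m * ρ (s - t) = s ^ k)
    {ξ : Euc n} (hξ : ‖ξ‖ = 1) :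
    rayMoment m (rayTest hα hαc hα0 hρ hρc hφc) ξ =
      α ξ • slice (contDiff_inner_pow_mul_perp k φ) ξ := by
  refine Subtype.ext (funext fun x => ?_)
  have hinner : ∀ t : ℝ, inner ℝ (x - t • ξ) ξ = inner ℝ x ξ - t := fun t => by
    rw [inner_sub_left, inner_smul_left, real_inner_self_eq_norm_sq, hξ]
    simp
  calc (rayMoment m (rayTest hα hαc hα0 hρ hρc hφc) ξ).1 x
      = ∫ t : ℝ, ((t ^ m * ρ (inner ℝ x ξ - t) : ℝ) : ℂ) * ((α ξ : ℂ) * φ.1 (perp ξ x)) := by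
        rw [rayMoment_apply]
        refine integral_congr_ae (.of_forall fun t => ?_)
        simp only [rayTest, perp_sub_smul hξ, hinner, Complex.ofReal_mul, Complex.ofReal_pow]
        ring
    _ = ((inner ℝ x ξ ^ k : ℝ) : ℂ) * ((α ξ : ℂ) * φ.1 (perp ξ x)) := by
        rw [integral_mul_const, integral_complex_ofReal, hρm]
    _ = α ξ • (((inner ℝ x ξ : ℝ) : ℂ) ^ k * φ.1 (perp ξ x)) := by
        rw [Complex.real_smul, Complex.ofReal_pow]
        ring

end

theorem contractSum_rayWave_eq_zero {F : TensorSum n m} (hF : sphereTransform m F = 0)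
    {ξ y : Euc n} (hξ : ‖ξ‖ = 1) (hξy : inner ℝ ξ y = 0) {k : ℕ} (hk : k ≤ m) :
    (contractSum ξ F).1 (rayWave k ξ y) = 0 := by
  obtain ⟨ρ, hρ, hρc, hρm⟩ := exists_contDiff_integral_pow_mul_comp_sub_eq_pow hk
  obtain ⟨R, hR⟩ := exists_pairing_eq_of_eqOn_ball (contractSum ξ F)
  obtain ⟨φ, hφc, hφ⟩ := exists_hasCompactSupport_eq_on_ball (planeWave y) R
  let B : Euc n → ℂ := fun η =>
    (contractSum η F).1 (slice (contDiff_inner_pow_mul_perp k φ) η)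
  have hB : Continuous B := by
    simp only [B, contractSum, Submodule.coe_sum, LinearMap.sum_apply]
    exact continuous_finsetSum _ fun p _ => continuous_contract_pairing _ continuous_id
      (continuous_iteratedFDeriv_right (contDiff_inner_pow_mul_perp k φ))
  have hBξ : B ξ = 0 := by
    refine eq_zero_on_sphere_of_integral_smul_eq_zero hB (fun α hα hαc hα0 => ?_) hξ
    have htest := congrFun hF (rayTest hα hαc hα0 hρ hρc hφc)
    rw [sphereTransform, momentRayTransform_eq_integral, Pi.zero_apply] at htest
    rw [← htest]
    refine integral_congr_ae ?_
    filter_upwards [ae_norm_eq_one n] with η hη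
    rw [rayMoment_rayTest hα hαc hα0 hρ hρc hφc hρm hη, LinearMap.map_smul_of_tower]
  rw [← hBξ]
  refine hR _ _ fun x hx => ?_
  simp only [rayWave, slice, hφ _ ((norm_perp_le hξ x).trans_lt hx), planeWave_perp hξy]

end RayTests

section Parity

variable {n m p q : ℕ}

/-- Reversing the ray is what separates the even ranks from the odd ones. -/
theorem contract_neg_rayWave (f : SymTensor n p) (k : ℕ) (ξ y : Euc n) :
    (contract (-ξ) f).1 (rayWave k (-ξ) y) =
      (-1) ^ p * ((-1) ^ k * (contract ξ f).1 (rayWave k ξ y)) := by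
  rw [← neg_one_smul ℝ ξ, contract_smul, rayWave_smul, map_smul]
  simp [mul_left_comm]

theorem eq_zero_of_contract_add_rayWave_eq_zero (hn : 2 ≤ n) (hp : p ≤ m) (hq : q ≤ m)
    (hpe : Even p) (hqo : Odd q) {e : SymTensor n p} {o : SymTensor n q}
    (h : ∀ ξ y : Euc n, ‖ξ‖ = 1 → inner ℝ ξ y = 0 → ∀ k ≤ m,
      (contract ξ e).1 (rayWave k ξ y) + (contract ξ o).1 (rayWave k ξ y) = 0) :
    e = 0 ∧ o = 0 := by
  have hneg : ∀ ξ y : Euc n, ‖ξ‖ = 1 → inner ℝ ξ y = 0 → ∀ k ≤ m,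
      (contract ξ e).1 (rayWave k ξ y) - (contract ξ o).1 (rayWave k ξ y) = 0 := by
    intro ξ y hξ hξy k hk
    have hopp := h (-ξ) y (by rwa [norm_neg]) (by rw [inner_neg_left, hξy, neg_zero]) k hk
    rw [contract_neg_rayWave, contract_neg_rayWave, hpe.neg_one_pow, hqo.neg_one_pow, one_mul,
      neg_one_mul, ← sub_eq_add_neg, ← mul_sub] at hopp
    exact (mul_eq_zero.1 hopp).resolve_left (pow_ne_zero _ (neg_ne_zero.2 one_ne_zero))
  refine ⟨eq_zero_of_forall_contract_rayWave hn hp fun ξ y hξ hξy k hk => ?_,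
    eq_zero_of_forall_contract_rayWave hn hq fun ξ y hξ hξy k hk => ?_⟩
  · linear_combination (h ξ y hξ hξy k hk + hneg ξ y hξ hξy k hk) / 2
  · linear_combination (h ξ y hξ hξy k hk - hneg ξ y hξ hξy k hk) / 2

theorem evenPart_eq_zero_and_oddPart_eq_zero (hn : 2 ≤ n) (hm : 1 ≤ m) {F : TensorSum n m}
    (hF : sphereTransform m F = 0) : evenPart F = 0 ∧ oddPart hm F = 0 := by
  refine eq_zero_of_contract_add_rayWave_eq_zero hn (m := m) (by omega) (by omega)
    (even_two_mul _) (odd_two_mul_add_one _) fun ξ y hξ hξy k hk => ?_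
  have hsum := contractSum_rayWave_eq_zero hF hξ hξy hk
  rwa [contractSum_eq_evenPart_add_oddPart hm F hξ] at hsum

theorem sphereTransform_eq_zero_of_parts (hm : 1 ≤ m) {F : TensorSum n m}
    (he : evenPart F = 0) (ho : oddPart hm F = 0) (k : ℕ) : sphereTransform k F = 0 :=
  sphereTransform_eq_zero_of_contractSum (fun ξ hξ => by
    rw [contractSum_eq_evenPart_add_oddPart hm F hξ, he, ho, map_zero, map_zero, add_zero]) k

theorem sphereTransform_zero (k : ℕ) : sphereTransform k (0 : TensorSum n m) = 0 :=
  sphereTransform_eq_zero_of_contractSum (fun ξ _ => by simp [contractSum]) k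

theorem eq_zero_of_sphereTransform_of_le_one (hn : 2 ≤ n) (hm : m ≤ 1) {F : TensorSum n m}
    (hF : sphereTransform m F = 0) : F = 0 := by
  obtain rfl | rfl : m = 0 ∨ m = 1 := by omega
  · funext p
    obtain rfl : p = 0 := Fin.fin_one_eq_zero p
    refine eq_zero_of_forall_contract_rayWave hn le_rfl fun ξ y hξ hξy k hk => ?_
    simpa [contractSum] using contractSum_rayWave_eq_zero hF hξ hξy hk
  · obtain ⟨he, ho⟩ := evenPart_eq_zero_and_oddPart_eq_zero hn le_rfl hF
    funext p
    fin_cases p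
    · exact (add_zero (F 0)).symm.trans he
    · exact (add_zero (F 1)).symm.trans ho

end Parity

end MRT

end

theorem mainTheorem6 (n m : ℕ) (hn : 2 ≤ n) (F : MRT.TensorSum n m) :
    (∀ hm : 2 ≤ m,
      List.TFAE [
        MRT.sphereTransform m F = 0,
        ∀ k ≤ m, MRT.sphereTransform k F = 0,
        MRT.EvenRelation F ∧ MRT.OddRelation (one_le_two.trans hm) F]) ∧
    (m ≤ 1 →
      List.TFAE [
        MRT.sphereTransform m F = 0,
        ∀ k ≤ m, MRT.sphereTransform k F = 0,
        F = 0]) := by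
  refine ⟨fun hm => ?_, fun hm => ?_⟩
  · rw [MRT.evenRelation_iff, MRT.oddRelation_iff]
    tfae_have 1 → 3 := MRT.evenPart_eq_zero_and_oddPart_eq_zero hn _
    tfae_have 3 → 2 := fun h k _ => MRT.sphereTransform_eq_zero_of_parts _ h.1 h.2 k
    tfae_have 2 → 1 := fun h => h m le_rfl
    tfae_finish
  · tfae_have 1 → 3 := MRT.eq_zero_of_sphereTransform_of_le_one hn hm
    tfae_have 3 → 2 := fun h k _ => h ▸ MRT.sphereTransform_zero k
    tfae_have 2 → 1 := fun h => h m le_rfl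
    tfae_finish
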